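/- Let $K$ be a field of characteristic $0$ and $X=\{x_1<\dots<x_n\}$, $n\ge 2$, a finite alphabet. Let $<$ be the pure lexicographic order on words (a proper left factor of a word is smaller than the word), and let $\prec$ be the degree-lexicographic order: $u\prec v$ iff $|u|<|v|$, or $|u|=|v|$ and $u>v$. A nonempty word $u$ is a Lyndon word if $u<ba$ whenever $u=ab$ with $a,b$ nonempty; $L_m$ is the set of Lyndon words of length $m$. The right standard bracketing of Lyndon words is defined by $[x_i]=x_i$ and $[w]=[[u],[v]]$ if $|w|\ge2$ and $w=uv$ with $v$ the longest proper right segment of $w$ that is a Lyndon word. For a set of words $V$, $[V]=\{[v] : v\in V\}$. A Lyndon pair $(N,W)$ consists of a set $W$ of Lyndon words of length at least $2$, none of which is a proper subword of another, and the set $N=N(W)$ of all Lyndon words that contain no element of $W$ as a subword. The class $\mathfrak C(X,W)$ consists of the algebras $A=K\langle X\rangle/I$, where $I$ is a two-sided ideal generated by homogeneous polynomials of degree $\ge 2$ (for the grading by length) whose set of obstructions is $W$; that is, $W$ is the set of those $\prec$-highest monomials of nonzero elements of $I$ that contain no other such highest monomial as a proper subword. A set $N$ of Lyndon words that contains $X$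 and all Lyndon subwords of its elements is called connected if $N\cap L_m\ne\emptyset$, $m\ge2$, implies $N\cap L_s\neq\emptyset$ for all $1\le s\le m$. A Lie algebra $\mathfrak g$ is nilpotent of nilpotency class $m$ if $m$ is minimal with $\mathfrak g^{m+1}=0$, where $\mathfrak g^1=\mathfrak g$, $\mathfrak g^t=[\mathfrak g^{t-1},\mathfrak g]$. Proposition. Let $(N,W)$ be a Lyndon pair, and let $\mathfrak g$ be a Lie algebra over $K$ with elements $x_1,\dots,x_n\in\mathfrak g$ such that the enveloping algebra $U\mathfrak g$, with the generators $x_1,\dots,x_n$, belongs to $\mathfrak C(X,W)$ (that is, the homomorphism $K\langle X\rangle\to U\mathfrak g$ sending each letter $x_i$ to the element $x_i$ is surjective and its kernel $I$ is as above). Then the following conditions hold. 1. If $N\cap L_s=\emptyset$ for some $s\ge2$, then $N\cap L_{s+k}=\emptyset$ for all $k\ge1$; in particular, $N$ is finite. Moreover, if $s$ is the minimal integer $\ge 2$ with this property, then $\mathfrak g$ is nilpotent of nilpotency class $s-1$. 2. If $N$ is infinite, then $N\cap L_m\ne\emptyset$ for all $m\ge1$. 3. If $N$ is finite, $|N|=d$,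 and $m=\max\{|u| : u\in N\}$, then $\mathfrak g$ is nilpotent of nilpotency class $m$, and $m\le d-|X|+1$. 4. $N$ is connected, and $[N]$, evaluated in $\mathfrak g$, is a $K$-basis of $\mathfrak g$ (with distinct words $u\in N$ giving distinct elements $[u]$). -/

import Mathlib

namespace LyndonAtoms

/-! Words in the alphabet `X = {x_1 < ⋯ < x_n}` are lists over `Fin n`. On lists `<` is the pure
lexicographic order (a proper left factor of `v` is smaller than `v`), `<:+:` is "is a subword of",
and `FreeAlgebra K (Fin n)` is `K⟨X⟩`. -/

/-- A Lyndon word: nonempty, and strictly smaller than each of its proper conjugates. -/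
def IsLyndon {n : ℕ} (u : List (Fin n)) : Prop :=
  u ≠ [] ∧ ∀ a b : List (Fin n), a ≠ [] → b ≠ [] → u = a ++ b → u < b ++ a

/-- The set `L_m` of Lyndon words of length `m`. -/
def lyndonOfLength (n m : ℕ) : Set (List (Fin n)) :=
  {u | IsLyndon u ∧ u.length = m}

/-- The degree-lexicographic order `u ≺ v` extending `x_1 ≻ x_2 ≻ ⋯ ≻ x_n`. -/
def DegLexLT {n : ℕ} (u v : List (Fin n)) : Prop :=
  u.length < v.length ∨ (u.length = v.length ∧ v < u)

/-- The words that are normal modulo `W`: no element of `W` occurs in them as a subword. -/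
def normalWords {n : ℕ} (W : Set (List (Fin n))) : Set (List (Fin n)) :=
  {a | ∀ w ∈ W, ¬ w <:+: a}

/-- `(N, W)` is a Lyndon pair: `W` is an antichain of Lyndon words (for the subword order)
containing no letter, and `N = N(W)` is the set of Lyndon words that are normal modulo `W`. -/
structure IsLyndonPair {n : ℕ} (N W : Set (List (Fin n))) : Prop where
  antichain : IsAntichain (fun u v => u <:+: v) W
  lyndon : ∀ w ∈ W, IsLyndon w
  no_letter : ∀ i : Fin n, [i] ∉ W
  atoms : N = {u | IsLyndon u} ∩ normalWords W

/-- A connected set of Lyndon atoms: a set of Lyndon words that contains all letters, is closed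
under taking Lyndon subwords, and has no gap in the lengths of its elements. -/
structure IsConnectedAtoms {n : ℕ} (N : Set (List (Fin n))) : Prop where
  lyndon : ∀ u ∈ N, IsLyndon u
  letters : ∀ i : Fin n, [i] ∈ N
  closed : ∀ u ∈ N, ∀ v, IsLyndon v → v <:+: u → v ∈ N
  connected : ∀ m, 2 ≤ m → (N ∩ lyndonOfLength n m).Nonempty →
    ∀ s, 1 ≤ s → s ≤ m → (N ∩ lyndonOfLength n s).Nonempty

section Algebra

variable {K : Type*} [Field K] {n : ℕ}

/-- The coefficient of the word `w` in the noncommutative polynomial `f`. -/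
noncomputable def coeff (f : FreeAlgebra K (Fin n)) (w : List (Fin n)) : K :=
  (FreeAlgebra.basisFreeMonoid K (Fin n)).repr f (FreeMonoid.ofList w)

/-- `f` is homogeneous of degree `m` for the grading of `K⟨X⟩` by length. -/
def IsHomogeneous (f : FreeAlgebra K (Fin n)) (m : ℕ) : Prop :=
  ∀ w, coeff f w ≠ 0 → w.length = m

/-- `w` is the highest monomial of `f` with respect to `≺` (in particular `f ≠ 0`). -/
def IsLeadingWord (f : FreeAlgebra K (Fin n)) (w : List (Fin n)) : Prop :=
  coeff f w ≠ 0 ∧ ∀ v, coeff f v ≠ 0 → v ≠ w → DegLexLT v w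

/-- The set of highest monomials of the nonzero elements of `I`. -/
def leadingWords (I : TwoSidedIdeal (FreeAlgebra K (Fin n))) : Set (List (Fin n)) :=
  {w | ∃ f ∈ I, IsLeadingWord f w}

/-- The set of obstructions `W(I)`: the highest monomials of elements of `I` that are minimal
for the subword order. -/
def obstructions (I : TwoSidedIdeal (FreeAlgebra K (Fin n))) : Set (List (Fin n)) :=
  {w | w ∈ leadingWords I ∧ ∀ v ∈ leadingWords I, v <:+: w → v = w}

/-- The ideal of relations between the elements `a_1, …, a_n` of `A`, that is, the kernel of
`K⟨X⟩ → A`, `x_i ↦ a_i`. -/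
noncomputable def relationIdeal {A : Type*} [Ring A] [Algebra K A] (a : Fin n → A) :
    TwoSidedIdeal (FreeAlgebra K (Fin n)) :=
  TwoSidedIdeal.ker (FreeAlgebra.lift K a)

/-- The algebra `A`, with generators `a_1, …, a_n`, belongs to the class `ℭ(X, W)`:
`A = K⟨X⟩ / I` where `I` is generated by homogeneous polynomials of degree at least `2`, and
the set of obstructions of `I` is `W`. -/
structure InClass (K : Type*) [Field K] {n : ℕ} (W : Set (List (Fin n)))
    {A : Type*} [Ring A] [Algebra K A] (a : Fin n → A) : Prop where
  generates : Function.Surjective (FreeAlgebra.lift K a)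
  graded : ∃ R : Set (FreeAlgebra K (Fin n)),
    (∀ f ∈ R, ∃ m, 2 ≤ m ∧ IsHomogeneous f m) ∧ relationIdeal (K := K) a = TwoSidedIdeal.span R
  obstructions_eq : obstructions (relationIdeal (K := K) a) = W

end Algebra

/-- The position at which the right standard factorization cuts a word `w` of length at least `2`:
`w.drop (stdCut w)` is the longest proper right segment of `w` that is a Lyndon word.
(The value is `0` if `w` has length at most `1`.) -/
noncomputable def stdCut {n : ℕ} (w : List (Fin n)) : ℕ :=
  sInf {k | 0 < k ∧ k < w.length ∧ IsLyndon (w.drop k)}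

/-- The right standard bracketing `[w]`, evaluated at the elements `x_1, …, x_n` of a Lie ring:
`[x_i] = x_i`, and `[w] = ⁅[u], [v]⁆` if `w = (u, v)` is the right standard factorization. -/
noncomputable def stdBracket {n : ℕ} {g : Type*} [LieRing g] (x : Fin n → g)
    (w : List (Fin n)) : g :=
  if _h : 0 < stdCut w ∧ stdCut w < w.length then
    ⁅stdBracket x (w.take (stdCut w)), stdBracket x (w.drop (stdCut w))⁆
  else
    match (generalizing := false) w with
    | [i] => x i
    | _ => 0
termination_by w.length
decreasing_by
  · rw [List.length_take]; omega
  · rw [List.length_drop]; omega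

/-- `g` is nilpotent of nilpotency class `m`: `m` is minimal with `g^(m+1) = 0`, where
`g^1 = g` and `g^t = [g^(t-1), g]`. (Mathlib's `lowerCentralSeries K g g m` is `g^(m+1)`.) -/
def IsNilpotentOfClass (K g : Type*) [Field K] [LieRing g] [LieAlgebra K g] (m : ℕ) : Prop :=
  IsLeast {k | LieModule.lowerCentralSeries K g g k = ⊥} m

end LyndonAtoms

/-! Write `U𝔤 = K⟨X⟩/I`. Two facts carry the proof: `[N]` is a basis of `𝔤`, and, since `I` is
homogeneous, the lengths of the words in `N` determine the lower central series.

Basis. The standard bracketing `[u]` of a Lyndon word has highest monomial `u`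
(`stdBracket_sub_mem_upperSpan`). A nontrivial relation between the `[u]`, `u ∈ N`, would make some
word of `N` a highest monomial of `I`; such a word contains an obstruction, which normality excludes
(`linearIndepOn_stdBracket`). For spanning, a normal word is a nonincreasing product of Lyndon
words, all in `N`, and is the highest monomial of the product of their bracketings. Hence ordered
products of elements of `[N]` span `U𝔤`. If a basis of `𝔤` extending `[N]` had a further element,
this would contradict Poincaré–Birkhoff–Witt, which is proved here by letting `𝔤` act on polynomials
in a basis (`span_stdBracket_eq_top`).

Grading. Let `𝔤_k` be the span of the iterated brackets of `k` generators. An element of `𝔤_k` lifts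
to a homogeneous polynomial of degree `k`; comparing homogeneous components modulo `I`, only words
of length `k` occur in its expansion in `[N]`. So `𝔤_k = 0` exactly when `N` has no word of length
`k`. Since `𝔤_{k+1} = [X, 𝔤_k]`, vanishing propagates upwards, and `𝔤^k` is the sum of the `𝔤_j`
with `j ≥ k`. This gives `lowerCentralSeries_eq_bot_iff`, from which all statements on lengths and
nilpotency class follow. -/

namespace LyndonAtoms

attribute [local instance 100] LieRing.ofAssociativeRing

/-! ### Combinatorics of Lyndon words. -/

section Words

variable {n : ℕ}

/-- In the second case the words differ at some letter, so whatever is appended cannot affect the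
comparison. -/
theorem prefix_or_strict_of_lt {u v : List (Fin n)} (h : u < v) :
    (∃ c, c ≠ [] ∧ v = u ++ c) ∨ ∀ s t, u ++ s < v ++ t := by
  induction u generalizing v with
  | nil =>
    refine Or.inl ⟨v, ?_, rfl⟩
    rintro rfl
    exact absurd h (List.not_lt_nil _)
  | cons a u ih =>
    cases v with
    | nil => exact absurd h (List.not_lt_nil _)
    | cons b v =>
      rcases List.cons_lt_cons_iff.1 h with hab | ⟨rfl, huv⟩
      · exact Or.inr fun s t => List.cons_lt_cons_iff.2 (Or.inl hab)
      · rcases ih huv with ⟨c, hc, rfl⟩ | hs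
        · exact Or.inl ⟨c, hc, rfl⟩
        · exact Or.inr fun s t => List.cons_lt_cons_iff.2 (Or.inr ⟨rfl, hs s t⟩)

theorem append_lt_append_of_lt {u v : List (Fin n)} (h : u < v) (hl : v.length ≤ u.length)
    (s t : List (Fin n)) : u ++ s < v ++ t := by
  rcases prefix_or_strict_of_lt h with ⟨c, hc, rfl⟩ | hs
  · have := List.length_pos_iff.2 hc
    rw [List.length_append] at hl
    omega
  · exact hs s t

theorem append_left_lt_iff (p : List (Fin n)) {u v : List (Fin n)} :
    p ++ u < p ++ v ↔ u < v := by
  induction p with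
  | nil => rfl
  | cons a p ih => simp [ih]

theorem lt_append_of_ne_nil (u : List (Fin n)) {c : List (Fin n)} (hc : c ≠ []) : u < u ++ c := by
  obtain ⟨a, c, rfl⟩ := List.exists_cons_of_ne_nil hc
  simpa using (append_left_lt_iff u (u := []) (v := a :: c)).2 (List.nil_lt_cons _ _)

theorem lt_append_of_lt {u v : List (Fin n)} (h : u < v) (c : List (Fin n)) : u < v ++ c := by
  rcases eq_or_ne c [] with rfl | hc
  · simpa using h
  · exact h.trans (lt_append_of_ne_nil v hc)

/-- Suppose `b < ab`. If they differ at a letter, then `ba < ab`, which is excluded. Otherwise `ab =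
bc` with `|c| = |a|`; now `ab < ba` gives `c < a`, hence `cb < ab`, while the Lyndon condition for
the cut `bc` gives `ab = bc < cb`. -/
theorem IsLyndon.lt_suffix {a b : List (Fin n)} (h : IsLyndon (a ++ b)) (ha : a ≠ [])
    (hb : b ≠ []) : a ++ b < b := by
  have hab := h.2 a b ha hb rfl
  rcases lt_trichotomy (a ++ b) b with hlt | heq | hgt
  · exact hlt
  · exact absurd (by simpa using heq) ha
  · rcases prefix_or_strict_of_lt hgt with ⟨c, hc, hbc⟩ | hs
    · have hlen : c.length = a.length := by
        have := congrArg List.length hbc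
        simp only [List.length_append] at this
        omega
      have hca : c < a := by
        rw [hbc, append_left_lt_iff] at hab
        exact hab
      have h1 : c ++ b < a ++ b := append_lt_append_of_lt hca hlen.ge b b
      have h2 := h.2 b c hb hc hbc
      exact absurd (h1.trans h2) (lt_irrefl _)
    · have := hs a []
      rw [List.append_nil] at this
      exact absurd (this.trans hab) (lt_irrefl _)

theorem isLyndon_of_lt_suffix {w : List (Fin n)} (hw : w ≠ [])
    (h : ∀ a b, a ≠ [] → b ≠ [] → w = a ++ b → w < b) : IsLyndon w :=
  ⟨hw, fun a b ha hb hab => lt_append_of_lt (h a b ha hb hab) a⟩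

theorem isLyndon_singleton (i : Fin n) : IsLyndon [i] := by
  refine isLyndon_of_lt_suffix (by simp) fun a b ha hb hab => ?_
  have := congrArg List.length hab
  have h1 := List.length_pos_iff.2 ha
  have h2 := List.length_pos_iff.2 hb
  simp only [List.length_append, List.length_singleton] at this
  omega

theorem IsLyndon.append_lt {u v : List (Fin n)} (hu : IsLyndon u) (hv : IsLyndon v)
    (huv : u < v) : u ++ v < v := by
  rcases prefix_or_strict_of_lt huv with ⟨c, hc, rfl⟩ | hs
  · exact (append_left_lt_iff u).2 (hv.lt_suffix hu.1 hc)
  · simpa using hs v []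

theorem IsLyndon.append {u v : List (Fin n)} (hu : IsLyndon u) (hv : IsLyndon v)
    (huv : u < v) : IsLyndon (u ++ v) := by
  have hlt := hu.append_lt hv huv
  refine isLyndon_of_lt_suffix (by simp [hu.1]) fun a b ha hb hab => ?_
  rcases List.append_eq_append_iff.1 hab with ⟨c, rfl, hvc⟩ | ⟨c, huc, rfl⟩
  · rcases eq_or_ne c [] with rfl | hc
    · rw [List.nil_append] at hvc
      exact hvc ▸ hlt
    · subst hvc
      exact hlt.trans (hv.lt_suffix hc hb)
  · rcases eq_or_ne c [] with rfl | hc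
    · simpa using hlt
    · subst huc
      have := hu.lt_suffix ha hc
      refine append_lt_append_of_lt this ?_ v v
      simp

/-- Every word is a product of a nonincreasing sequence of Lyndon words. -/
theorem exists_lyndon_factorization (w : List (Fin n)) :
    ∃ L : List (List (Fin n)), L.flatten = w ∧ (∀ u ∈ L, IsLyndon u) ∧
      L.Pairwise (fun u v => v ≤ u) := by
  -- A Lyndon word put in front is merged with the next factor as long as it is smaller than that
  -- factor; each merger shortens the list.
  have insert : ∀ (L : List (List (Fin n))) (u : List (Fin n)), IsLyndon u →
      (∀ u ∈ L, IsLyndon u) → L.Pairwise (fun u v => v ≤ u) →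
      ∃ L' : List (List (Fin n)), L'.flatten = u ++ L.flatten ∧ (∀ u ∈ L', IsLyndon u) ∧
        L'.Pairwise (fun u v => v ≤ u) := by
    intro L
    induction L with
    | nil => exact fun u hu _ _ => ⟨[u], by simp, by simpa using hu, by simp⟩
    | cons l L ih =>
      intro u hu hL hp
      rw [List.pairwise_cons] at hp
      have hl := hL l (by simp)
      rcases lt_or_ge u l with hul | hlu
      · obtain ⟨L', h1, h2⟩ := ih (u ++ l) (hu.append hl hul)
          (fun v hv => hL v (List.mem_cons_of_mem _ hv)) hp.2
        exact ⟨L', by simpa using h1, h2⟩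
      · refine ⟨u :: l :: L, by simp, ?_, ?_⟩
        · intro v hv
          rcases List.mem_cons.1 hv with rfl | hv
          exacts [hu, hL v hv]
        · refine List.pairwise_cons.2 ⟨fun v hv => ?_, List.pairwise_cons.2 hp⟩
          rcases List.mem_cons.1 hv with rfl | hv
          exacts [hlu, (hp.1 v hv).trans hlu]
  induction w with
  | nil => exact ⟨[], by simp⟩
  | cons a w ih =>
    obtain ⟨L, rfl, h2, h3⟩ := ih
    exact insert L [a] (isLyndon_singleton a) h2 h3

theorem stdCut_mem {w : List (Fin n)} (hw : 2 ≤ w.length) :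
    0 < stdCut w ∧ stdCut w < w.length ∧ IsLyndon (w.drop (stdCut w)) := by
  refine Nat.sInf_mem (s := {k | 0 < k ∧ k < w.length ∧ IsLyndon (w.drop k)})
    ⟨w.length - 1, by omega, by omega, ?_⟩
  rw [List.drop_length_sub_one (List.ne_nil_of_length_pos (by omega))]
  exact isLyndon_singleton _

theorem stdCut_le {w : List (Fin n)} {k : ℕ} (h0 : 0 < k) (hk : k < w.length)
    (h : IsLyndon (w.drop k)) : stdCut w ≤ k :=
  Nat.sInf_le ⟨h0, hk, h⟩

/-- Let `w = ab` be the standard factorization and let `l₁ ≥ ⋯ ≥ l` be the Lyndon factors of `a`.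
With more than one factor, `l < b` would make `lb` a longer proper Lyndon suffix, so `b ≤ l ≤ l₁ < w
< b`, a contradiction. -/
theorem IsLyndon.take_stdCut {w : List (Fin n)} (hw : IsLyndon w) (h2 : 2 ≤ w.length) :
    IsLyndon (w.take (stdCut w)) := by
  obtain ⟨h0, hlt, hb⟩ := stdCut_mem h2
  have htd := List.take_append_drop (stdCut w) w
  have hlen : (w.take (stdCut w)).length = stdCut w := by rw [List.length_take]; omega
  generalize hadef : w.take (stdCut w) = a at *
  generalize hbdef : w.drop (stdCut w) = b at *
  obtain ⟨L, hLa, hLy, hLp⟩ := exists_lyndon_factorization a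
  have hane : a ≠ [] := List.ne_nil_of_length_pos (by omega)
  have hLne : L ≠ [] := by rintro rfl; exact hane (by simpa using hLa.symm)
  obtain ⟨L, l, rfl⟩ : ∃ L' l, L = L' ++ [l] := ⟨_, _, (List.dropLast_append_getLast hLne).symm⟩
  rcases L with - | ⟨l₁, L⟩
  · have : l = a := by simpa using hLa
    exact this ▸ hLy l (by simp)
  exfalso
  have hl := hLy l (by simp)
  have hl₁ := hLy l₁ (by simp)
  have hll₁ : l ≤ l₁ := by
    rw [List.cons_append, List.pairwise_cons] at hLp
    exact hLp.1 l (by simp)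
  have hw' : w = (l₁ ++ L.flatten) ++ (l ++ b) := by rw [← htd, ← hLa]; simp
  have hlenw : a.length = (l₁ ++ L.flatten).length + l.length := by rw [← hLa]; simp; omega
  have hlpos := List.length_pos_iff.2 hl.1
  have hl₁pos := List.length_pos_iff.2 hl₁.1
  have hbl : b ≤ l := by
    by_contra! hlb
    have hly := hl.append hb hlb
    have hle := stdCut_le (w := w) (k := (l₁ ++ L.flatten).length) (by simp; omega)
      (by omega) (by rw [hw', List.drop_left]; exact hly)
    omega
  have h1 : w < b := by
    have := IsLyndon.lt_suffix (a := a) (b := b) (htd.symm ▸ hw) hane hb.1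
    rwa [htd] at this
  have h2 : l₁ < w := by
    rw [hw', List.append_assoc]
    exact lt_append_of_ne_nil l₁ (by simp [hl.1])
  exact absurd (h2.trans (h1.trans_le (hbl.trans hll₁))) (lt_irrefl _)

end Words

/-! ### The degree-lexicographic order. -/

section Monomials

variable {n : ℕ}

theorem degLexLT_iff {u v : List (Fin n)} :
    DegLexLT u v ↔ toLex (u.length, OrderDual.toDual u) < toLex (v.length, OrderDual.toDual v) := by
  rw [Prod.Lex.toLex_lt_toLex]
  rfl

theorem DegLexLT.trans {u v w : List (Fin n)} (h : DegLexLT u v) (h' : DegLexLT v w) :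
    DegLexLT u w := by
  rw [degLexLT_iff] at *
  exact h.trans h'

theorem not_degLexLT_self (u : List (Fin n)) : ¬ DegLexLT u u := by
  rw [degLexLT_iff]
  exact lt_irrefl _

theorem degLexLT_trichotomy {u v : List (Fin n)} (h : u ≠ v) : DegLexLT u v ∨ DegLexLT v u := by
  simp only [degLexLT_iff]
  refine lt_or_gt_of_ne fun h' => h ?_
  simpa using congrArg (fun p => OrderDual.ofDual (ofLex p).2) h'

theorem DegLexLT.append_append {u v : List (Fin n)} (h : DegLexLT u v) (a b : List (Fin n)) :
    DegLexLT (a ++ u ++ b) (a ++ v ++ b) := by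
  rcases h with h | ⟨hl, h⟩
  · left
    simp only [List.length_append]
    omega
  · right
    refine ⟨by simp [hl], ?_⟩
    rw [List.append_assoc, List.append_assoc, append_left_lt_iff]
    exact append_lt_append_of_lt h hl.le b b

/-- The alphabet is finite, so each word has finitely many predecessors, and their number is a rank
function. -/
theorem wellFounded_degLexLT : WellFounded (DegLexLT (n := n)) := by
  have hfin : ∀ w : List (Fin n), {v | DegLexLT v w}.Finite := fun w =>
    (List.finite_length_le (Fin n) w.length).subset fun v hv => by
      rcases hv with h | ⟨h, -⟩
      exacts [h.le, h.le]
  refine Subrelation.wf (r := InvImage (· < ·) fun w => {v | DegLexLT v w}.ncard) ?_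
    (InvImage.wf _ wellFounded_lt)
  intro u v huv
  refine Set.ncard_lt_ncard ⟨fun w hw => DegLexLT.trans hw huv, fun hsub => ?_⟩ (hfin v)
  exact not_degLexLT_self u (hsub huv)

end Monomials

/-! ### Highest monomials, standard bracketings and obstructions. -/

section Algebra

variable {K : Type*} [Field K] {n : ℕ}

variable (K) in
/-- The words as a basis of the free algebra. -/
noncomputable def wordBasis (n : ℕ) : Module.Basis (List (Fin n)) K (FreeAlgebra K (Fin n)) :=
  (FreeAlgebra.basisFreeMonoid K (Fin n)).reindex FreeMonoid.toList

theorem coeff_eq (f : FreeAlgebra K (Fin n)) (w : List (Fin n)) :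
    coeff f w = (wordBasis K n).repr f w := by
  simp [wordBasis, coeff]

theorem wordBasis_apply (w : List (Fin n)) :
    wordBasis K n w = (w.map (FreeAlgebra.ι K)).prod := by
  simp only [wordBasis, FreeAlgebra.basisFreeMonoid, Module.Basis.reindex_apply,
    Module.Basis.map_apply]
  simp [FreeAlgebra.equivMonoidAlgebraFreeMonoid, FreeMonoid.lift_apply]

theorem wordBasis_append (u v : List (Fin n)) :
    wordBasis K n (u ++ v) = wordBasis K n u * wordBasis K n v := by
  simp [wordBasis_apply]

theorem wordBasis_singleton (i : Fin n) : wordBasis K n [i] = FreeAlgebra.ι K i := by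
  simp [wordBasis_apply]

variable (K) in
/-- The span of the words below `w` in the degree-lexicographic order. -/
def lowerSpan (w : List (Fin n)) : Submodule K (FreeAlgebra K (Fin n)) :=
  Submodule.span K (wordBasis K n '' {v | DegLexLT v w})

variable (K) in
/-- The span of the words of the length of `w` that are lexicographically larger than `w`. -/
def upperSpan (w : List (Fin n)) : Submodule K (FreeAlgebra K (Fin n)) :=
  Submodule.span K (wordBasis K n '' {v | v.length = w.length ∧ w < v})

theorem upperSpan_le_lowerSpan (w : List (Fin n)) : upperSpan K w ≤ lowerSpan K w :=
  Submodule.span_mono (Set.image_mono fun _ hv => Or.inr hv)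

theorem lowerSpan_mono {u v : List (Fin n)} (h : DegLexLT u v) : lowerSpan K u ≤ lowerSpan K v :=
  Submodule.span_mono (Set.image_mono fun _ hw => DegLexLT.trans hw h)

theorem mem_lowerSpan_iff {f : FreeAlgebra K (Fin n)} {w : List (Fin n)} :
    f ∈ lowerSpan K w ↔ ∀ v, coeff f v ≠ 0 → DegLexLT v w := by
  rw [lowerSpan, Module.Basis.mem_span_image]
  simp only [coeff_eq, Set.subset_def, Finset.mem_coe, Finsupp.mem_support_iff, Set.mem_ofPred_eq]

theorem isLeadingWord_iff {f : FreeAlgebra K (Fin n)} {w : List (Fin n)} :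
    IsLeadingWord f w ↔ ∃ c : K, c ≠ 0 ∧ f - c • wordBasis K n w ∈ lowerSpan K w := by
  have hc : ∀ (c : K) v, coeff (f - c • wordBasis K n w) v =
      coeff f v - if v = w then c else 0 := by
    intro c v
    simp [coeff_eq, Finsupp.single_apply, eq_comm]
  constructor
  · rintro ⟨h0, h⟩
    refine ⟨coeff f w, h0, mem_lowerSpan_iff.2 fun v hv => ?_⟩
    rw [hc] at hv
    rcases eq_or_ne v w with rfl | hvw
    · simp at hv
    · rw [if_neg hvw, sub_zero] at hv
      exact h v hv hvw
  · rintro ⟨c, hc0, h⟩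
    rw [mem_lowerSpan_iff] at h
    constructor
    · intro h0
      refine not_degLexLT_self w (h w ?_)
      simpa [hc, h0] using hc0
    · intro v hv hvw
      exact h v (by simpa [hc, hvw] using hv)

theorem span_image_mul_le {s t r : Set (List (Fin n))}
    (h : ∀ u ∈ s, ∀ v ∈ t, u ++ v ∈ r) :
    Submodule.span K (wordBasis K n '' s) * Submodule.span K (wordBasis K n '' t) ≤
      Submodule.span K (wordBasis K n '' r) := by
  rw [Submodule.span_mul_span, Submodule.span_le]
  rintro _ ⟨_, ⟨u, hu, rfl⟩, _, ⟨v, hv, rfl⟩, rfl⟩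
  exact Submodule.subset_span ⟨u ++ v, h u hu v hv, wordBasis_append u v⟩

theorem IsLeadingWord.mul_mul {f : FreeAlgebra K (Fin n)} {w : List (Fin n)}
    (h : IsLeadingWord f w) (a b : List (Fin n)) :
    IsLeadingWord (wordBasis K n a * f * wordBasis K n b) (a ++ w ++ b) := by
  rw [isLeadingWord_iff] at *
  obtain ⟨c, hc, h⟩ := h
  refine ⟨c, hc, ?_⟩
  have h1 : wordBasis K n a * (f - c • wordBasis K n w) * wordBasis K n b =
      wordBasis K n a * f * wordBasis K n b - c • wordBasis K n (a ++ w ++ b) := by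
    simp [wordBasis_append, mul_sub, sub_mul, mul_assoc]
  rw [← h1]
  have ha : wordBasis K n a ∈ Submodule.span K (wordBasis K n '' {a}) :=
    Submodule.subset_span (by simp)
  have hb : wordBasis K n b ∈ Submodule.span K (wordBasis K n '' {b}) :=
    Submodule.subset_span (by simp)
  have h2 := span_image_mul_le (r := {v | ∃ u, DegLexLT u w ∧ v = a ++ u})
    (by rintro _ rfl v hv; exact ⟨v, hv, rfl⟩) (Submodule.mul_mem_mul ha h)
  refine span_image_mul_le ?_ (Submodule.mul_mem_mul h2 hb)
  rintro _ ⟨u, hu, rfl⟩ _ rfl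
  exact hu.append_append a _

/-- Highest monomials multiply: between words of equal length a strict lexicographic comparison
survives appending anything on the right. -/
theorem sub_wordBasis_mem_upperSpan_mul {f g : FreeAlgebra K (Fin n)} {u v : List (Fin n)}
    (hf : f - wordBasis K n u ∈ upperSpan K u) (hg : g - wordBasis K n v ∈ upperSpan K v) :
    f * g - wordBasis K n (u ++ v) ∈ upperSpan K (u ++ v) := by
  have hg' : g ∈ Submodule.span K (wordBasis K n '' {w | w.length = v.length ∧ v ≤ w}) := by
    rw [← sub_add_cancel g (wordBasis K n v)]
    refine add_mem (Submodule.span_mono (Set.image_mono ?_) hg)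
      (Submodule.subset_span ⟨v, ⟨rfl, le_rfl⟩, rfl⟩)
    exact fun w hw => ⟨hw.1, hw.2.le⟩
  have hu : wordBasis K n u ∈ Submodule.span K (wordBasis K n '' {u}) :=
    Submodule.subset_span (by simp)
  have key : f * g - wordBasis K n (u ++ v) =
      (f - wordBasis K n u) * g + wordBasis K n u * (g - wordBasis K n v) := by
    rw [wordBasis_append]
    noncomm_ring
  rw [key]
  refine add_mem (span_image_mul_le ?_ (Submodule.mul_mem_mul hf hg'))
    (span_image_mul_le ?_ (Submodule.mul_mem_mul hu hg))
  · rintro a ⟨ha, ha'⟩ b ⟨hb, -⟩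
    exact ⟨by simp [ha, hb], append_lt_append_of_lt ha' ha.le _ _⟩
  · rintro _ rfl b ⟨hb, hb'⟩
    exact ⟨by simp [hb], (append_left_lt_iff _).2 hb'⟩

theorem mem_upperSpan_of_lt {f : FreeAlgebra K (Fin n)} {u v : List (Fin n)}
    (hf : f - wordBasis K n u ∈ upperSpan K u) (hl : u.length = v.length) (h : v < u) :
    f ∈ upperSpan K v := by
  rw [← sub_add_cancel f (wordBasis K n u)]
  refine add_mem (Submodule.span_mono (Set.image_mono ?_) hf)
    (Submodule.subset_span ⟨u, ⟨hl, h⟩, rfl⟩)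
  exact fun w hw => ⟨hw.1.trans hl, h.trans hw.2⟩

theorem stdBracket_of_two_le {g : Type*} [LieRing g] (x : Fin n → g) {w : List (Fin n)}
    (h : 2 ≤ w.length) : stdBracket x w =
      ⁅stdBracket x (w.take (stdCut w)), stdBracket x (w.drop (stdCut w))⁆ := by
  rw [stdBracket.eq_def, dif_pos ⟨(stdCut_mem h).1, (stdCut_mem h).2.1⟩]

theorem stdBracket_singleton {g : Type*} [LieRing g] (x : Fin n → g) (i : Fin n) :
    stdBracket x [i] = x i := by
  rw [stdBracket.eq_def, dif_neg]
  simp only [List.length_singleton]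
  omega

/-- Induction along the right standard factorization of Lyndon words. -/
theorem IsLyndon.stdCut_induction {P : List (Fin n) → Prop} (letter : ∀ i, P [i])
    (step : ∀ w, IsLyndon w → 2 ≤ w.length → P (w.take (stdCut w)) → P (w.drop (stdCut w)) → P w)
    {w : List (Fin n)} (hw : IsLyndon w) : P w := by
  induction hl : w.length using Nat.strong_induction_on generalizing w with
  | _ m ih =>
    subst hl
    rcases lt_or_ge w.length 2 with h | h
    · have := List.length_pos_iff.2 hw.1
      obtain ⟨i, rfl⟩ := List.length_eq_one_iff.1 (show w.length = 1 by omega)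
      exact letter i
    · obtain ⟨h0, hlt, hb⟩ := stdCut_mem h
      exact step w hw h (ih _ (by rw [List.length_take]; omega) (hw.take_stdCut h) rfl)
        (ih _ (by rw [List.length_drop]; omega) hb rfl)

/-- The highest monomial of the standard bracketing of a Lyndon word `w` is `w`. -/
theorem stdBracket_sub_mem_upperSpan {w : List (Fin n)} (hw : IsLyndon w) :
    stdBracket (FreeAlgebra.ι K) w - wordBasis K n w ∈ upperSpan K w := by
  refine IsLyndon.stdCut_induction
    (P := fun w => stdBracket (FreeAlgebra.ι K) w - wordBasis K n w ∈ upperSpan K w)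
    (fun i => ?_) (fun w hw h ha hb => ?_) hw
  · rw [stdBracket_singleton, wordBasis_singleton, sub_self]
    exact zero_mem _
  · obtain ⟨h0, hlt, hL⟩ := stdCut_mem h
    rw [stdBracket_of_two_le _ h]
    have htd := List.take_append_drop (stdCut w) w
    have hane : w.take (stdCut w) ≠ [] := (hw.take_stdCut h).1
    generalize w.take (stdCut w) = a at *
    generalize w.drop (stdCut w) = b at *
    have h1 := sub_wordBasis_mem_upperSpan_mul ha hb
    -- In the commutator the reversed product contributes only larger words, because `ab < ba` for a
    -- Lyndon word `ab`.
    have h2 := mem_upperSpan_of_lt (v := w) (sub_wordBasis_mem_upperSpan_mul hb ha)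
      (by rw [← htd]; simp [add_comm]) (hw.2 a b hane hL.1 htd.symm)
    rw [htd] at h1
    rw [LieRing.of_associative_ring_bracket, sub_right_comm]
    exact sub_mem h1 h2

/-- Stated for additive maps so that it applies both to `K⟨X⟩ → U𝔤` and to `𝔤 → U𝔤`. -/
theorem map_stdBracket {g h : Type*} [LieRing g] [LieRing h] (f : g →+ h)
    (hf : ∀ a b, f ⁅a, b⁆ = ⁅f a, f b⁆) (x : Fin n → g) {w : List (Fin n)} (hw : IsLyndon w) :
    f (stdBracket x w) = stdBracket (fun i => f (x i)) w := by
  refine IsLyndon.stdCut_induction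
    (P := fun w => f (stdBracket x w) = stdBracket (fun i => f (x i)) w)
    (fun i => ?_) (fun w hw h ha hb => ?_) hw
  · rw [stdBracket_singleton, stdBracket_singleton]
  · rw [stdBracket_of_two_le _ h, stdBracket_of_two_le _ h, hf, ha, hb]

theorem exists_obstruction_infix {I : TwoSidedIdeal (FreeAlgebra K (Fin n))} {w : List (Fin n)}
    (hw : w ∈ leadingWords I) : ∃ v ∈ obstructions I, v <:+: w := by
  induction hl : w.length using Nat.strong_induction_on generalizing w with
  | _ m ih =>
    subst hl
    by_cases h : ∀ v ∈ leadingWords I, v <:+: w → v = w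
    · exact ⟨w, ⟨hw, h⟩, List.infix_rfl⟩
    · push Not at h
      obtain ⟨v, hv, hvw, hne⟩ := h
      have hlt : v.length < w.length :=
        lt_of_le_of_ne hvw.length_le fun he => hne (hvw.eq_of_length he)
      obtain ⟨o, ho, hov⟩ := ih _ hlt hv rfl
      exact ⟨o, ho, hov.trans hvw⟩

theorem mem_leadingWords_of_infix {I : TwoSidedIdeal (FreeAlgebra K (Fin n))}
    {v w : List (Fin n)} (hv : v ∈ leadingWords I) (h : v <:+: w) : w ∈ leadingWords I := by
  obtain ⟨a, b, rfl⟩ := h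
  obtain ⟨f, hf, hfv⟩ := hv
  exact ⟨_, I.mul_mem_right _ _ (I.mul_mem_left _ _ hf), hfv.mul_mul a b⟩

/-- A combination of monic polynomials whose highest monomials are distinct and not highest
monomials of elements of `I` lies in `I` only if it is trivial. -/
theorem eq_zero_of_sum_mem {I : TwoSidedIdeal (FreeAlgebra K (Fin n))}
    {p : List (Fin n) → FreeAlgebra K (Fin n)} (s : Finset (List (Fin n)))
    (hp : ∀ u ∈ s, p u - wordBasis K n u ∈ lowerSpan K u)
    (hs : ∀ u ∈ s, u ∉ leadingWords I) {c : List (Fin n) → K}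
    (hc : ∑ u ∈ s, c u • p u ∈ I) : ∀ u ∈ s, c u = 0 := by
  classical
  by_contra! hne
  obtain ⟨w, hws, hw0⟩ := hne
  -- The highest word with nonzero coefficient cannot cancel, so it is the highest monomial of the
  -- sum.
  obtain ⟨u, hu, hmax⟩ := Finset.exists_max_image (s.filter fun u => c u ≠ 0)
    (fun u => toLex (u.length, OrderDual.toDual u)) ⟨w, Finset.mem_filter.2 ⟨hws, hw0⟩⟩
  rw [Finset.mem_filter] at hu
  refine hs u hu.1 ⟨_, hc, isLeadingWord_iff.2 ⟨c u, hu.2, ?_⟩⟩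
  rw [← Finset.add_sum_erase s _ hu.1, add_sub_right_comm, ← smul_sub]
  refine add_mem (Submodule.smul_mem _ _ (hp u hu.1)) (Submodule.sum_mem _ fun v hv => ?_)
  rw [Finset.mem_erase] at hv
  rcases eq_or_ne (c v) 0 with h0 | h0
  · rw [h0, zero_smul]
    exact zero_mem _
  have hvu : DegLexLT v u := by
    refine (degLexLT_trichotomy hv.1).resolve_right fun h => ?_
    exact absurd (hmax v (Finset.mem_filter.2 ⟨hv.2, h0⟩)) (not_le.2 (degLexLT_iff.1 h))
  refine Submodule.smul_mem _ _ ?_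
  rw [← sub_add_cancel (p v) (wordBasis K n v)]
  exact add_mem (lowerSpan_mono hvu (hp v hv.2)) (Submodule.subset_span ⟨v, hvu, rfl⟩)

/-- A subspace of `A` contains the image of `K⟨X⟩ → A` if every word is a highest monomial of
an element of the kernel or of a polynomial whose value lies in the subspace. -/
theorem mem_of_forall_isLeadingWord {A : Type*} [Ring A] [Algebra K A]
    (φ : FreeAlgebra K (Fin n) →ₐ[K] A) (M : Submodule K A)
    (h : ∀ w, ∃ f, IsLeadingWord f w ∧ φ f ∈ M) (f : FreeAlgebra K (Fin n)) : φ f ∈ M := by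
  have hw : ∀ w, φ (wordBasis K n w) ∈ M := by
    intro w
    induction w using wellFounded_degLexLT.induction with
    | _ w ih =>
      obtain ⟨f, hf, hM⟩ := h w
      obtain ⟨c, hc, hlow⟩ := isLeadingWord_iff.1 hf
      have hle : lowerSpan K w ≤ M.comap φ.toLinearMap := by
        rw [lowerSpan, Submodule.span_le]
        rintro _ ⟨v, hv, rfl⟩
        exact ih v hv
      have h1 : φ f - c • φ (wordBasis K n w) ∈ M := by simpa using hle hlow
      have h2 := sub_mem hM h1
      rw [sub_sub_cancel] at h2
      exact (Submodule.smul_mem_iff _ hc).1 h2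
  have htop : (⊤ : Submodule K (FreeAlgebra K (Fin n))) ≤ M.comap φ.toLinearMap := by
    rw [← (wordBasis K n).span_eq, Submodule.span_le]
    rintro _ ⟨v, rfl⟩
    exact hw v
  exact htop Submodule.mem_top

end Algebra

/-! ### The Poincaré–Birkhoff–Witt theorem. -/

section PBW

variable {R g ι : Type*} [CommRing R] [LieRing g] [LieAlgebra R g]

variable (R) in
/-- A commutative monomial in variables indexed by `ι`. -/
noncomputable def mon (m : Multiset ι) : Multiset ι →₀ R := Finsupp.single m 1

variable (R ι) in
/-- The span of the commutative monomials of degree at most `d`. -/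
noncomputable def monFiltration (d : ℕ) : Submodule R (Multiset ι →₀ R) :=
  Submodule.span R (mon R '' {m | Multiset.card m ≤ d})

theorem mon_mem_monFiltration {m : Multiset ι} {d : ℕ} (h : Multiset.card m ≤ d) :
    mon R m ∈ monFiltration R ι d :=
  Submodule.subset_span ⟨m, h, rfl⟩

theorem monFiltration_mono {d e : ℕ} (h : d ≤ e) : monFiltration R ι d ≤ monFiltration R ι e :=
  Submodule.span_mono (Set.image_mono fun _ hm => le_trans hm h)

theorem exists_mem_monFiltration (s : Multiset ι →₀ R) : ∃ d, s ∈ monFiltration R ι d := by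
  induction s using Finsupp.induction_linear with
  | zero => exact ⟨0, zero_mem _⟩
  | add s t hs ht =>
    obtain ⟨d, hd⟩ := hs
    obtain ⟨e, he⟩ := ht
    exact ⟨max d e, add_mem (monFiltration_mono (le_max_left _ _) hd)
      (monFiltration_mono (le_max_right _ _) he)⟩
  | single m c =>
    refine ⟨Multiset.card m, ?_⟩
    have : Finsupp.single m c = c • mon R m := by simp [mon]
    exact this ▸ Submodule.smul_mem _ _ (mon_mem_monFiltration le_rfl)

theorem mem_of_basis (b : Module.Basis ι R g) {M : Type*} [AddCommGroup M] [Module R M]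
    (T : g →ₗ[R] M) (P : Submodule R M) (h : ∀ i, T (b i) ∈ P) (x : g) : T x ∈ P := by
  have htop : (⊤ : Submodule R g) ≤ P.comap T := by
    rw [← b.span_eq, Submodule.span_le]
    rintro _ ⟨i, rfl⟩
    exact h i
  exact htop Submodule.mem_top

theorem mem_of_basis_of_mon (b : Module.Basis ι R g) {M : Type*} [AddCommGroup M] [Module R M]
    (T : g →ₗ[R] (Multiset ι →₀ R) →ₗ[R] M) (P : Submodule R M) {d : ℕ}
    (h : ∀ i m, Multiset.card m ≤ d → T (b i) (mon R m) ∈ P) (x : g) {s : Multiset ι →₀ R}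
    (hs : s ∈ monFiltration R ι d) : T x s ∈ P := by
  have hle : monFiltration R ι d ≤ P.comap (T x) := by
    rw [monFiltration, Submodule.span_le]
    rintro _ ⟨m, hm, rfl⟩
    exact mem_of_basis b (T.flip (mon R m)) P (fun i => h i m hm) x
  exact hle hs

theorem eq_of_basis_of_mon (b : Module.Basis ι R g) {M : Type*} [AddCommGroup M] [Module R M]
    (T T' : g →ₗ[R] (Multiset ι →₀ R) →ₗ[R] M) {d : ℕ}
    (h : ∀ i m, Multiset.card m ≤ d → T (b i) (mon R m) = T' (b i) (mon R m)) (x : g)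
    {s : Multiset ι →₀ R} (hs : s ∈ monFiltration R ι d) : T x s = T' x s := by
  have := mem_of_basis_of_mon b (T - T') ⊥ (d := d)
    (fun i m hm => by simp [h i m hm]) x hs
  simpa [sub_eq_zero] using this

theorem mem_monFiltration_succ (b : Module.Basis ι R g)
    {T : g →ₗ[R] (Multiset ι →₀ R) →ₗ[R] (Multiset ι →₀ R)} {d : ℕ}
    (h : ∀ i m, Multiset.card m ≤ d →
      T (b i) (mon R m) - mon R (i ::ₘ m) ∈ monFiltration R ι (Multiset.card m))
    {e : ℕ} (he : e ≤ d) (x : g) {s : Multiset ι →₀ R} (hs : s ∈ monFiltration R ι e) :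
    T x s ∈ monFiltration R ι (e + 1) := by
  refine mem_of_basis_of_mon b T _ (fun i m hm => ?_) x hs
  rw [← sub_add_cancel (T (b i) (mon R m)) (mon R (i ::ₘ m))]
  exact add_mem (monFiltration_mono (by omega) (h i m (hm.trans he)))
    (mon_mem_monFiltration (by simpa using hm))

variable [LinearOrder ι]

theorem forall_le_or_exists_lt (i : ι) (m : Multiset ι) :
    (∀ a ∈ m, i ≤ a) ∨ ∃ j l, m = j ::ₘ l ∧ (∀ a ∈ l, j ≤ a) ∧ j < i := by
  by_cases h : ∀ a ∈ m, i ≤ a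
  · exact Or.inl h
  · push Not at h
    obtain ⟨a, ha, hai⟩ := h
    obtain ⟨j, hj, hmin⟩ := Finset.exists_min_image m.toFinset id ⟨a, by simpa using ha⟩
    simp only [Multiset.mem_toFinset, id] at hj hmin
    exact Or.inr ⟨j, m.erase j, (Multiset.cons_erase hj).symm,
      fun c hc => hmin c (Multiset.mem_of_mem_erase hc), (hmin a ha).trans_lt hai⟩

variable (b : Module.Basis ι R g)

/-- One step in the recursive construction of the action of `g` on polynomials: the action on
monomials is prescribed by the action `L` on monomials of smaller degree. -/
noncomputable def pbwStep (L : g →ₗ[R] (Multiset ι →₀ R) →ₗ[R] (Multiset ι →₀ R)) :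
    g →ₗ[R] (Multiset ι →₀ R) →ₗ[R] (Multiset ι →₀ R) :=
  b.constr R fun i => Finsupp.linearCombination R fun m =>
    match m.sort with
    | [] => mon R (i ::ₘ m)
    | j :: l =>
      if i ≤ j then mon R (i ::ₘ m)
      -- Here `j < i` is the least variable of `m = jl`, and the formula is forced by `b_i b_j l =
      -- b_j b_i l + [b_i, b_j] l`: the top term `il` of `b_i l` yields the monomial `jil`, and the
      -- remainder has smaller degree.
      else mon R (i ::ₘ m) + L (b j) (L (b i) (mon R (l : Multiset ι)) - mon R (i ::ₘ l)) +
        L ⁅b i, b j⁆ (mon R (l : Multiset ι))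

theorem pbwStep_of_le (L : g →ₗ[R] (Multiset ι →₀ R) →ₗ[R] (Multiset ι →₀ R)) {i : ι}
    {m : Multiset ι} (h : ∀ a ∈ m, i ≤ a) :
    pbwStep b L (b i) (mon R m) = mon R (i ::ₘ m) := by
  rw [pbwStep, Module.Basis.constr_basis, mon, Finsupp.linearCombination_single, one_smul]
  split
  · rfl
  · next j l hs =>
    have : j ∈ m.sort := hs ▸ List.mem_cons_self
    exact if_pos (h j (by simpa using this))

theorem pbwStep_of_lt (L : g →ₗ[R] (Multiset ι →₀ R) →ₗ[R] (Multiset ι →₀ R)) {i j : ι}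
    {l : Multiset ι} (h : ∀ a ∈ l, j ≤ a) (hji : j < i) :
    pbwStep b L (b i) (mon R (j ::ₘ l)) = mon R (i ::ₘ j ::ₘ l) +
      L (b j) (L (b i) (mon R l) - mon R (i ::ₘ l)) + L ⁅b i, b j⁆ (mon R l) := by
  rw [pbwStep, Module.Basis.constr_basis, mon, Finsupp.linearCombination_single, one_smul]
  have hsort := Multiset.sort_cons j l (r := (· ≤ ·)) h
  split
  · next hs => exact absurd (hs.symm.trans hsort) (by simp)
  · next j' l' hs =>
    obtain ⟨rfl, rfl⟩ := List.cons.inj (hs.symm.trans hsort)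
    rw [if_neg (not_le.2 hji), Multiset.sort_eq]

/-- The action of `g` on polynomials of degree at most `d`. -/
noncomputable def pbwApprox : ℕ → g →ₗ[R] (Multiset ι →₀ R) →ₗ[R] (Multiset ι →₀ R)
  -- Only the value at the constant monomial matters here.
  | 0 => b.constr R fun i => Finsupp.linearCombination R fun m => mon R (i ::ₘ m)
  | d + 1 => pbwStep b (pbwApprox d)

theorem pbwApprox_of_le (d : ℕ) {i : ι} {m : Multiset ι} (h : ∀ a ∈ m, i ≤ a) :
    pbwApprox b d (b i) (mon R m) = mon R (i ::ₘ m) := by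
  cases d with
  | zero => simp [pbwApprox, mon]
  | succ d => exact pbwStep_of_le b _ h

/-- The action is multiplication up to terms of no larger degree than `m`. This keeps the recursion
within the degrees already treated. -/
theorem pbwApprox_sub_mem (d : ℕ) (i : ι) (m : Multiset ι) (hm : Multiset.card m ≤ d) :
    pbwApprox b d (b i) (mon R m) - mon R (i ::ₘ m) ∈ monFiltration R ι (Multiset.card m) := by
  induction d generalizing i m with
  | zero =>
    rw [pbwApprox_of_le b 0 (by simp [Multiset.card_eq_zero.1 (Nat.le_zero.1 hm)]), sub_self]
    exact zero_mem _
  | succ d ih =>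
    rcases forall_le_or_exists_lt i m with h | ⟨j, l, rfl, hjl, hji⟩
    · rw [pbwApprox_of_le b _ h, sub_self]
      exact zero_mem _
    · rw [Multiset.card_cons] at hm ⊢
      have hl : Multiset.card l ≤ d := by omega
      rw [pbwApprox, pbwStep_of_lt b _ hjl hji, add_assoc, add_sub_cancel_left]
      exact add_mem (mem_monFiltration_succ b ih hl _ (ih i l hl))
        (mem_monFiltration_succ b ih hl _ (mon_mem_monFiltration le_rfl))

theorem pbwApprox_succ (d : ℕ) (x : g) {s : Multiset ι →₀ R} (hs : s ∈ monFiltration R ι d) :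
    pbwApprox b (d + 1) x s = pbwApprox b d x s := by
  induction d generalizing x s with
  | zero =>
    refine eq_of_basis_of_mon b _ _ (fun i m hm => ?_) x hs
    have : ∀ a ∈ m, i ≤ a := by simp [Multiset.card_eq_zero.1 (Nat.le_zero.1 hm)]
    rw [pbwApprox_of_le b _ this, pbwApprox_of_le b _ this]
  | succ d ih =>
    refine eq_of_basis_of_mon b _ _ (fun i m hm => ?_) x hs
    rcases forall_le_or_exists_lt i m with h | ⟨j, l, rfl, hjl, hji⟩
    · rw [pbwApprox_of_le b _ h, pbwApprox_of_le b _ h]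
    · rw [Multiset.card_cons] at hm
      have hl : Multiset.card l ≤ d := by omega
      rw [pbwApprox, pbwStep_of_lt b _ hjl hji, pbwApprox, pbwStep_of_lt b _ hjl hji]
      rw [← pbwApprox, ih _ (mon_mem_monFiltration hl), ih _ (mon_mem_monFiltration hl),
        ih _ (monFiltration_mono hl (pbwApprox_sub_mem b d i l hl))]

theorem pbwApprox_of_mem {d e : ℕ} (hde : d ≤ e) (x : g) {s : Multiset ι →₀ R}
    (hs : s ∈ monFiltration R ι d) : pbwApprox b e x s = pbwApprox b d x s := by
  induction e, hde using Nat.le_induction with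
  | base => rfl
  | succ e hde ih => rw [pbwApprox_succ b e x (monFiltration_mono hde hs), ih]

/-- The action of `g` on polynomials in the elements of a basis of `g`. -/
noncomputable def pbwAction : g →ₗ[R] (Multiset ι →₀ R) →ₗ[R] (Multiset ι →₀ R) :=
  b.constr R fun i => Finsupp.linearCombination R fun m =>
    pbwApprox b (Multiset.card m) (b i) (mon R m)

theorem pbwAction_eq {d : ℕ} (x : g) {s : Multiset ι →₀ R} (hs : s ∈ monFiltration R ι d) :
    pbwAction b x s = pbwApprox b d x s := by
  refine eq_of_basis_of_mon b _ _ (fun i m hm => ?_) x hs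
  rw [pbwApprox_of_mem b hm _ (mon_mem_monFiltration le_rfl)]
  rw [pbwAction, Module.Basis.constr_basis]
  conv_lhs => rw [mon, Finsupp.linearCombination_single, one_smul]

theorem pbwAction_of_le {i : ι} {m : Multiset ι} (h : ∀ a ∈ m, i ≤ a) :
    pbwAction b (b i) (mon R m) = mon R (i ::ₘ m) := by
  rw [pbwAction_eq b _ (mon_mem_monFiltration le_rfl), pbwApprox_of_le b _ h]

theorem pbwAction_sub_mem (i : ι) (m : Multiset ι) :
    pbwAction b (b i) (mon R m) - mon R (i ::ₘ m) ∈ monFiltration R ι (Multiset.card m) := by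
  rw [pbwAction_eq b _ (mon_mem_monFiltration le_rfl)]
  exact pbwApprox_sub_mem b _ i m le_rfl

/-- In this case the Lie identity is the definition of the action, with the top term `jil` absorbed
into `b_j b_i l`. -/
theorem pbwAction_lie_of_lt {i j : ι} {l : Multiset ι} (h : ∀ a ∈ l, j ≤ a) (hji : j < i) :
    pbwAction b (b i) (pbwAction b (b j) (mon R l)) =
      pbwAction b (b j) (pbwAction b (b i) (mon R l)) + pbwAction b ⁅b i, b j⁆ (mon R l) := by
  have hl := mon_mem_monFiltration (R := R) (m := l) le_rfl
  have h1 : pbwAction b (b j) (mon R (i ::ₘ l)) = mon R (j ::ₘ i ::ₘ l) := by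
    refine pbwAction_of_le b fun a ha => ?_
    rcases Multiset.mem_cons.1 ha with rfl | ha
    exacts [hji.le, h a ha]
  rw [pbwAction_of_le b h,
    pbwAction_eq b _ (mon_mem_monFiltration (R := R) (m := j ::ₘ l) (Multiset.card_cons _ _).le),
    pbwApprox, pbwStep_of_lt b _ h hji, ← pbwAction_eq b _ hl, ← pbwAction_eq b _ hl,
    ← pbwAction_eq b _ (pbwAction_sub_mem b i l), map_sub, h1, Multiset.cons_swap]
  abel

/-- The defect of the Lie identity for the action of `g` on polynomials. -/
noncomputable def pbwDefect : g →ₗ[R] g →ₗ[R] Module.End R (Multiset ι →₀ R) :=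
  LinearMap.mk₂ R (fun x y => (pbwAction b x * pbwAction b y - pbwAction b y * pbwAction b x -
      pbwAction b ⁅x, y⁆ : Module.End R (Multiset ι →₀ R)))
    (fun x x' y => by simp only [map_add, add_lie, add_mul, mul_add]; abel)
    (fun c x y => LinearMap.ext fun s => by simp [smul_sub])
    (fun x y y' => by simp only [map_add, lie_add, add_mul, mul_add]; abel)
    (fun c x y => LinearMap.ext fun s => by simp [smul_sub])

theorem pbwDefect_apply (x y : g) (s : Multiset ι →₀ R) :
    pbwDefect b x y s = pbwAction b x (pbwAction b y s) - pbwAction b y (pbwAction b x s) -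
      pbwAction b ⁅x, y⁆ s := rfl

theorem pbwDefect_swap (x y : g) (s : Multiset ι →₀ R) :
    pbwDefect b x y s = - pbwDefect b y x s := by
  rw [pbwDefect_apply, pbwDefect_apply, ← lie_skew x y, map_neg, LinearMap.neg_apply]
  abel

theorem pbwDefect_eq_zero_of_lt {i j : ι} {l : Multiset ι} (h : ∀ a ∈ l, j ≤ a) (hji : j < i) :
    pbwDefect b (b i) (b j) (mon R l) = 0 := by
  rw [pbwDefect_apply, pbwAction_lie_of_lt b h hji]
  abel

theorem pbwDefect_eq_zero_of_basis {s : Multiset ι →₀ R}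
    (h : ∀ i j, pbwDefect b (b i) (b j) s = 0) (x y : g) : pbwDefect b x y s = 0 := by
  have h1 : ∀ i, pbwDefect b (b i) y s = 0 := fun i =>
    mem_of_basis b ((pbwDefect b (b i)).flip s) ⊥ (h i) y
  exact mem_of_basis b (((pbwDefect b).flip y).flip s) ⊥ h1 x

theorem pbwDefect_eq_zero_of_mem (d : ℕ) (x y : g) {s : Multiset ι →₀ R}
    (hs : s ∈ monFiltration R ι d) : pbwDefect b x y s = 0 := by
  induction d using Nat.strong_induction_on generalizing x y s with
  | _ d ih =>
  suffices hmon : ∀ m : Multiset ι, Multiset.card m ≤ d → ∀ i j,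
      pbwDefect b (b i) (b j) (mon R m) = 0 by
    have hle : monFiltration R ι d ≤ LinearMap.ker (pbwDefect b x y) := by
      rw [monFiltration, Submodule.span_le]
      rintro _ ⟨m, hm, rfl⟩
      exact pbwDefect_eq_zero_of_basis b (hmon m hm) x y
    exact hle hs
  -- it suffices to treat the case that the monomial has a variable smaller than `i` and `j`
  suffices hmain : ∀ (k : ι) (l : Multiset ι), Multiset.card l < d → (∀ a ∈ l, k ≤ a) →
      ∀ i j, k < i → k < j → pbwDefect b (b i) (b j) (mon R (k ::ₘ l)) = 0 by
    have hlt : ∀ m : Multiset ι, Multiset.card m ≤ d → ∀ i j, j < i →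
        pbwDefect b (b i) (b j) (mon R m) = 0 := by
      intro m hm i j hji
      rcases forall_le_or_exists_lt j m with h | ⟨k, l, rfl, hkl, hkj⟩
      · exact pbwDefect_eq_zero_of_lt b h hji
      · rw [Multiset.card_cons] at hm
        exact hmain k l (by omega) hkl i j (hkj.trans hji) hkj
    intro m hm i j
    rcases lt_trichotomy i j with h | rfl | h
    · rw [pbwDefect_swap, hlt m hm j i h, neg_zero]
    · simp [pbwDefect_apply]
    · exact hlt m hm i j h
  intro k l hl hkl i j hki hkj
  have comm : ∀ x y, pbwAction b x (pbwAction b y (mon R l)) =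
      pbwAction b y (pbwAction b x (mon R l)) + pbwAction b ⁅x, y⁆ (mon R l) := by
    intro x y
    have := ih _ hl x y (mon_mem_monFiltration (R := R) (m := l) le_rfl)
    rw [pbwDefect_apply, sub_sub, sub_eq_zero] at this
    exact this
  -- Split `b_j l` into `jl` and a remainder of degree at most that of `l`: `k` is least in `jl`, so
  -- the identity holds there by construction, and induction covers the remainder.
  have comm' : ∀ i j, k < i → k < j →
      pbwAction b (b i) (pbwAction b (b k) (pbwAction b (b j) (mon R l))) =
        pbwAction b (b k) (pbwAction b (b i) (pbwAction b (b j) (mon R l))) +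
          pbwAction b ⁅b i, b k⁆ (pbwAction b (b j) (mon R l)) := by
    intro i j hki hkj
    rw [← sub_eq_zero, ← sub_sub, ← pbwDefect_apply,
      ← sub_add_cancel (pbwAction b (b j) (mon R l)) (mon R (j ::ₘ l)), map_add,
      ih _ hl _ _ (pbwAction_sub_mem b j l), zero_add]
    refine pbwDefect_eq_zero_of_lt b (fun a ha => ?_) hki
    rcases Multiset.mem_cons.1 ha with rfl | ha
    exacts [hkj.le, hkl a ha]
  have expand : ∀ i j, k < i → k < j →
      pbwAction b (b i) (pbwAction b (b j) (pbwAction b (b k) (mon R l))) =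
        pbwAction b (b k) (pbwAction b (b i) (pbwAction b (b j) (mon R l))) +
        pbwAction b ⁅b i, b k⁆ (pbwAction b (b j) (mon R l)) +
        (pbwAction b ⁅b j, b k⁆ (pbwAction b (b i) (mon R l)) +
        pbwAction b ⁅b i, ⁅b j, b k⁆⁆ (mon R l)) := by
    intro i j hki hkj
    rw [comm (b j) (b k), map_add, comm' i j hki hkj, comm (b i) ⁅b j, b k⁆]
  -- After writing `kl` as `b_k l` and moving `b_k` to the left, the remaining terms cancel by the
  -- Jacobi identity.
  have hlie : ⁅⁅b i, b j⁆, b k⁆ = ⁅b i, ⁅b j, b k⁆⁆ - ⁅b j, ⁅b i, b k⁆⁆ := lie_lie _ _ _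
  rw [← pbwAction_of_le b hkl, pbwDefect_apply, expand i j hki hkj, expand j i hkj hki,
    comm ⁅b i, b j⁆ (b k), comm (b i) (b j), hlie]
  simp only [map_add, map_sub, LinearMap.sub_apply]
  abel

/-- The representation of `g` on polynomials in the elements of a basis of `g`. -/
noncomputable def pbwRep : g →ₗ⁅R⁆ Module.End R (Multiset ι →₀ R) :=
  { pbwAction b with
    map_lie' := by
      intro x y
      refine LinearMap.ext fun s => ?_
      obtain ⟨d, hd⟩ := exists_mem_monFiltration s
      have := pbwDefect_eq_zero_of_mem b d x y hd
      rw [pbwDefect_apply, sub_eq_zero] at this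
      exact this.symm }

/-- **Poincaré–Birkhoff–Witt**: a linear map from the enveloping algebra to polynomials takes the
ordered products of the elements of a basis to the corresponding monomials. -/
theorem exists_linearMap_ordered_prod_eq :
    ∃ Ψ : UniversalEnvelopingAlgebra R g →ₗ[R] (Multiset ι →₀ R),
      ∀ l : List ι, l.Pairwise (· ≤ ·) →
        Ψ (l.map fun i => UniversalEnvelopingAlgebra.ι R (b i)).prod = mon R (l : Multiset ι) := by
  -- Evaluate the representation at the polynomial `1`.
  refine ⟨(LinearMap.applyₗ (mon R 0)).comp
    (UniversalEnvelopingAlgebra.lift R (pbwRep b)).toLinearMap, fun l hl => ?_⟩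
  change UniversalEnvelopingAlgebra.lift R (pbwRep b) _ (mon R 0) = _
  induction l with
  | nil => simp
  | cons i l ih =>
    rw [List.pairwise_cons] at hl
    rw [List.map_cons, List.prod_cons, map_mul, Module.End.mul_apply, ih hl.2,
      UniversalEnvelopingAlgebra.lift_ι_apply]
    exact pbwAction_of_le b hl.1

end PBW

/-! ### The standard bracketings of `N` form a basis of `𝔤`. -/

section Spanning

variable {K : Type*} [Field K] {n : ℕ} {g : Type*} [LieRing g] [LieAlgebra K g]

variable (K) in
/-- The homomorphism `K⟨X⟩ → U𝔤`, `x_i ↦ x_i`. -/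
noncomputable def evalHom (x : Fin n → g) :
    FreeAlgebra K (Fin n) →ₐ[K] UniversalEnvelopingAlgebra K g :=
  FreeAlgebra.lift K fun i => UniversalEnvelopingAlgebra.ι K (x i)

variable (K) in
/-- The kernel of `K⟨X⟩ → U𝔤`. -/
noncomputable abbrev relations (x : Fin n → g) : TwoSidedIdeal (FreeAlgebra K (Fin n)) :=
  relationIdeal (K := K) fun i => UniversalEnvelopingAlgebra.ι K (x i)

theorem mem_relations {x : Fin n → g} {f : FreeAlgebra K (Fin n)} :
    f ∈ relations K x ↔ evalHom K x f = 0 :=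
  TwoSidedIdeal.mem_ker _

theorem evalHom_stdBracket (x : Fin n → g) {w : List (Fin n)} (hw : IsLyndon w) :
    evalHom K x (stdBracket (FreeAlgebra.ι K) w) =
      UniversalEnvelopingAlgebra.ι K (stdBracket x w) := by
  have h1 := map_stdBracket (evalHom K x : _ →+ UniversalEnvelopingAlgebra K g)
    (fun a b => by simp [LieRing.of_associative_ring_bracket]) (FreeAlgebra.ι K) hw
  have h2 := map_stdBracket
    (UniversalEnvelopingAlgebra.ι K : g →ₗ⁅K⁆ UniversalEnvelopingAlgebra K g).toLinearMap.toAddMonoidHom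
    (fun a b => LieHom.map_lie (UniversalEnvelopingAlgebra.ι K) a b) x hw
  refine h1.trans (Eq.trans ?_ h2.symm)
  congr 1
  funext i
  exact FreeAlgebra.lift_ι_apply _ _

theorem prod_stdBracket_sub_mem (L : List (List (Fin n))) (hL : ∀ u ∈ L, IsLyndon u) :
    (L.map (stdBracket (FreeAlgebra.ι K))).prod - wordBasis K n L.flatten ∈
      upperSpan K L.flatten := by
  induction L with
  | nil => simp [wordBasis_apply]
  | cons u L ih =>
    rw [List.map_cons, List.prod_cons, List.flatten_cons]
    exact sub_wordBasis_mem_upperSpan_mul (stdBracket_sub_mem_upperSpan (hL u (by simp)))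
      (ih fun v hv => hL v (List.mem_cons_of_mem _ hv))

variable {N W : Set (List (Fin n))}

theorem notMem_leadingWords {I : TwoSidedIdeal (FreeAlgebra K (Fin n))}
    (hW : obstructions I = W) {w : List (Fin n)} (hw : w ∈ normalWords W) :
    w ∉ leadingWords I := fun h => by
  obtain ⟨v, hv, hvw⟩ := exists_obstruction_infix h
  exact hw v (hW ▸ hv) hvw

theorem mem_normalWords {I : TwoSidedIdeal (FreeAlgebra K (Fin n))}
    (hW : obstructions I = W) {w : List (Fin n)} (hw : w ∉ leadingWords I) :
    w ∈ normalWords W := fun v hv hvw => by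
  rw [← hW] at hv
  exact hw (mem_leadingWords_of_infix hv.1 hvw)

/-- A relation between the standard bracketings of normal Lyndon words is trivial. -/
theorem eq_zero_of_sum_stdBracket_mem {I : TwoSidedIdeal (FreeAlgebra K (Fin n))}
    (hNW : IsLyndonPair N W) (hW : obstructions I = W) (s : Finset (List (Fin n)))
    (hs : ↑s ⊆ N) {c : List (Fin n) → K}
    (hc : ∑ u ∈ s, c u • stdBracket (FreeAlgebra.ι K) u ∈ I) : ∀ u ∈ s, c u = 0 := by
  have hN : ∀ u ∈ s, IsLyndon u ∧ u ∈ normalWords W := fun u hu => by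
    have := hs hu
    rwa [hNW.atoms] at this
  exact eq_zero_of_sum_mem s
    (fun u hu => upperSpan_le_lowerSpan u (stdBracket_sub_mem_upperSpan (hN u hu).1))
    (fun u hu => notMem_leadingWords hW (hN u hu).2) hc

/-- A linear relation in `𝔤`, carried to `U𝔤`, puts the same combination of bracketings in `K⟨X⟩`
into `I`. -/
theorem linearIndepOn_stdBracket (hNW : IsLyndonPair N W) (x : Fin n → g)
    (hW : obstructions (relations K x) = W) : LinearIndepOn K (stdBracket x) N := by
  rw [linearIndepOn_iff_linearIndepOn_finset]
  intro s hs
  rw [linearIndepOn_finset_iff]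
  intro c hc
  refine eq_zero_of_sum_stdBracket_mem hNW hW s hs (mem_relations.2 ?_)
  have hN : ∀ u ∈ s, IsLyndon u := fun u hu => by
    have := hs hu
    rw [hNW.atoms] at this
    exact this.1
  rw [map_sum, Finset.sum_congr rfl fun u hu => by rw [map_smul, evalHom_stdBracket x (hN u hu)]]
  have := congrArg (UniversalEnvelopingAlgebra.ι K) hc
  simpa only [map_sum, map_smul, map_zero] using this

theorem sumExtend_inl {ι V : Type*} [AddCommGroup V] [Module K V] {v : ι → V}
    (hv : LinearIndependent K v) (i : ι) : Module.Basis.sumExtend hv (Sum.inl i) = v i := by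
  simp [Module.Basis.sumExtend]
  rfl

theorem span_stdBracket_eq_top (hNW : IsLyndonPair N W) (x : Fin n → g)
    (hsurj : Function.Surjective (evalHom K x))
    (hW : obstructions (relations K x) = W) :
    Submodule.span K (Set.range fun u : N => stdBracket x (u : List (Fin n))) = ⊤ := by
  have hli : LinearIndependent K fun u : N => stdBracket x (u : List (Fin n)) :=
    linearIndepOn_stdBracket hNW x hW
  let J := Module.Basis.sumExtendIndex hli
  let _ : LinearOrder J := IsWellOrder.linearOrder WellOrderingRel
  -- a basis containing the `[u]`, ordered so that the `[u]` come first, for decreasing `u`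
  let e : N ⊕ J ≃ Nᵒᵈ ⊕ₗ J := (Equiv.sumCongr OrderDual.toDual (Equiv.refl J)).trans toLex
  let b : Module.Basis (Nᵒᵈ ⊕ₗ J) K g := (Module.Basis.sumExtend hli).reindex e
  have hb : ∀ u : N, b (e (Sum.inl u)) = stdBracket x (u : List (Fin n)) := fun u => by
    rw [Module.Basis.reindex_apply, Equiv.symm_apply_apply]
    exact sumExtend_inl hli u
  obtain ⟨Ψ, hΨ⟩ := exists_linearMap_ordered_prod_eq b
  -- The polynomials in the variables from `N` alone. Showing that `Ψ` takes values in `M` leaves no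
  -- room for the variables from `J`.
  let M : Submodule K (Multiset (Nᵒᵈ ⊕ₗ J) →₀ K) :=
    Finsupp.supported K K {m | ∀ a ∈ m, ∃ u, a = e (Sum.inl u)}
  have hM : ∀ z, Ψ z ∈ M := by
    intro z
    obtain ⟨f, rfl⟩ := hsurj z
    refine mem_of_forall_isLeadingWord (evalHom K x) (M.comap Ψ) (fun w => ?_) f
    -- A highest monomial of `I` is represented by an element of value zero, any other word by the
    -- product of the bracketings of its Lyndon factors.
    by_cases hw : w ∈ leadingWords (relations K x)
    · obtain ⟨f, hf, hfw⟩ := hw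
      exact ⟨f, hfw, by rw [mem_relations.1 hf]; exact zero_mem _⟩
    · have hnorm := mem_normalWords hW hw
      obtain ⟨L, rfl, hL, hLp⟩ := exists_lyndon_factorization w
      refine ⟨(L.map (stdBracket (FreeAlgebra.ι K))).prod, isLeadingWord_iff.2 ⟨1, one_ne_zero, ?_⟩,
        ?_⟩
      · rw [one_smul]
        exact upperSpan_le_lowerSpan _ (prod_stdBracket_sub_mem L hL)
      have hLN : ∀ u ∈ L, u ∈ N := fun u hu => by
        rw [hNW.atoms]
        refine ⟨hL u hu, fun v hv hvu => hnorm v hv (hvu.trans ?_)⟩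
        exact List.infix_of_mem_flatten hu
      lift L to List N using hLN
      have heq : evalHom K x
          ((L.map (fun u : N => (u : List (Fin n)))).map (stdBracket (FreeAlgebra.ι K))).prod =
          ((L.map fun u => e (Sum.inl u)).map
            fun i => UniversalEnvelopingAlgebra.ι K (b i)).prod := by
        rw [map_list_prod, List.map_map, List.map_map, List.map_map]
        refine congrArg List.prod (List.map_congr_left fun u hu => ?_)
        simp only [Function.comp_apply, hb]
        exact evalHom_stdBracket x (hL u (List.mem_map_of_mem hu))
      rw [Submodule.mem_comap, heq, hΨ]
      · refine Finsupp.single_mem_supported K _ fun a ha => ?_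
        obtain ⟨u, -, rfl⟩ := List.mem_map.1 (Multiset.mem_coe.1 ha)
        exact ⟨u, rfl⟩
      -- The Lyndon factors are nonincreasing, hence in order for the dual order on `N`.
      · rw [List.pairwise_map] at hLp ⊢
        refine hLp.imp fun {u v} huv => ?_
        exact Sum.Lex.inl_le_inl_iff.2 (OrderDual.toDual_le_toDual.2 huv)
  have hJ : IsEmpty J := by
    refine ⟨fun j => ?_⟩
    have h1 := hM (UniversalEnvelopingAlgebra.ι K (b (e (Sum.inr j))))
    have h2 := hΨ [e (Sum.inr j)] (by simp)
    rw [List.map_singleton, List.prod_singleton] at h2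
    rw [h2, mon, Finsupp.mem_supported, Finsupp.support_single _ one_ne_zero] at h1
    obtain ⟨u, hu⟩ := h1 (Finset.mem_coe.2 (Finset.mem_singleton_self _)) (e (Sum.inr j)) (by simp)
    simpa using e.injective hu
  rw [eq_top_iff, ← b.span_eq]
  refine Submodule.span_mono ?_
  rintro _ ⟨i, rfl⟩
  obtain ⟨u | j, rfl⟩ := e.surjective i
  · exact ⟨u, (hb u).symm⟩
  · exact isEmptyElim j

end Spanning

/-! ### Homogeneous components and the lower central series. -/

section Grading

variable {K : Type*} [Field K] {n : ℕ}

variable (K n) in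
/-- The homogeneous polynomials of degree `d`, as the span of the words of length `d`. -/
def homSpan (d : ℕ) : Submodule K (FreeAlgebra K (Fin n)) :=
  Submodule.span K (wordBasis K n '' {w | w.length = d})

theorem mem_homSpan_of_isHomogeneous {f : FreeAlgebra K (Fin n)} {d : ℕ}
    (h : IsHomogeneous f d) : f ∈ homSpan K n d := by
  rw [homSpan, Module.Basis.mem_span_image]
  intro w hw
  refine h w ?_
  rw [coeff_eq]
  exact Finsupp.mem_support_iff.1 hw

theorem mul_mem_homSpan {f f' : FreeAlgebra K (Fin n)} {d e : ℕ} (h : f ∈ homSpan K n d)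
    (h' : f' ∈ homSpan K n e) : f * f' ∈ homSpan K n (d + e) := by
  refine span_image_mul_le ?_ (Submodule.mul_mem_mul h h')
  rintro u rfl v rfl
  exact List.length_append

theorem stdBracket_mem_homSpan {u : List (Fin n)} (hu : IsLyndon u) :
    stdBracket (FreeAlgebra.ι K) u ∈ homSpan K n u.length := by
  rw [← sub_add_cancel (stdBracket (FreeAlgebra.ι K) u) (wordBasis K n u)]
  refine add_mem (Submodule.span_mono (Set.image_mono ?_) (stdBracket_sub_mem_upperSpan hu))
    (Submodule.subset_span ⟨u, rfl, rfl⟩)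
  exact fun v hv => hv.1

variable (K n) in
/-- The homomorphism `K⟨X⟩ → K⟨X⟩[t]`, `x_i ↦ x_i t`; the coefficient of `t ^ d` in the image of
a polynomial is its homogeneous component of degree `d`. -/
noncomputable def degreeHom :
    FreeAlgebra K (Fin n) →ₐ[K] Polynomial (FreeAlgebra K (Fin n)) :=
  FreeAlgebra.lift K fun i => Polynomial.monomial 1 (FreeAlgebra.ι K i)

theorem degreeHom_wordBasis (w : List (Fin n)) :
    degreeHom K n (wordBasis K n w) = Polynomial.monomial w.length (wordBasis K n w) := by
  induction w with
  | nil => simp [wordBasis_apply]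
  | cons i w ih =>
    rw [← List.singleton_append, wordBasis_append, map_mul, ih, wordBasis_singleton, degreeHom,
      FreeAlgebra.lift_ι_apply, Polynomial.monomial_mul_monomial, List.length_append,
      List.length_singleton]

theorem degreeHom_of_mem_homSpan {f : FreeAlgebra K (Fin n)} {d : ℕ} (h : f ∈ homSpan K n d) :
    degreeHom K n f = Polynomial.monomial d f := by
  induction h using Submodule.span_induction with
  | mem f hf =>
    obtain ⟨w, rfl, rfl⟩ := hf
    exact degreeHom_wordBasis w
  | zero => simp
  | add f f' _ _ h h' => rw [map_add, h, h', map_add]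
  | smul c f _ h => rw [map_smul, h, Polynomial.smul_monomial]

/-- The homogeneous components of an element of a homogeneous ideal lie in the ideal. -/
theorem coeff_degreeHom_mem {R : Set (FreeAlgebra K (Fin n))}
    (hR : ∀ f ∈ R, ∃ m, IsHomogeneous f m) {f : FreeAlgebra K (Fin n)}
    (hf : f ∈ TwoSidedIdeal.span R) (d : ℕ) :
    (degreeHom K n f).coeff d ∈ TwoSidedIdeal.span R := by
  set I := TwoSidedIdeal.span R with hI
  -- The polynomials with all components in `I` form an ideal, which contains the homogeneous
  -- generators.
  let J : TwoSidedIdeal (FreeAlgebra K (Fin n)) :=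
    TwoSidedIdeal.mk' {f | ∀ d, (degreeHom K n f).coeff d ∈ I}
      (fun d => by simp [I.zero_mem])
      (fun {f f'} h h' d => by simpa using I.add_mem (h d) (h' d))
      (fun {f} h d => by simpa using I.neg_mem (h d))
      (fun {f f'} h d => by
        rw [map_mul, Polynomial.coeff_mul]
        exact I.finsetSum_mem _ _ fun p _ => I.mul_mem_left _ _ (h p.2))
      (fun {f f'} h d => by
        rw [map_mul, Polynomial.coeff_mul]
        exact I.finsetSum_mem _ _ fun p _ => I.mul_mem_right _ _ (h p.1))
  have hJ : I ≤ J := by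
    rw [hI, TwoSidedIdeal.span_le]
    intro f hf
    rw [SetLike.mem_coe, TwoSidedIdeal.mem_mk']
    intro d
    obtain ⟨m, hm⟩ := hR f hf
    rw [degreeHom_of_mem_homSpan (mem_homSpan_of_isHomogeneous hm), Polynomial.coeff_monomial]
    split
    · exact TwoSidedIdeal.subset_span hf
    · exact I.zero_mem
  have := hJ hf
  rw [TwoSidedIdeal.mem_mk'] at this
  exact this d

variable {g : Type*} [LieRing g] [LieAlgebra K g]

variable (K) in
/-- The span of the left-normed products of `k + 1` of the elements `x_1, …, x_n`. -/
def leftNormed (x : Fin n → g) : ℕ → Submodule K g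
  | 0 => Submodule.span K (Set.range x)
  | k + 1 => Submodule.span K {a | ∃ i, ∃ v ∈ leftNormed x k, ⁅x i, v⁆ = a}

theorem lie_mem_leftNormed_succ {x : Fin n → g} (i : Fin n) {k : ℕ} {v : g}
    (hv : v ∈ leftNormed K x k) : ⁅x i, v⁆ ∈ leftNormed K x (k + 1) :=
  Submodule.subset_span ⟨i, v, hv, rfl⟩

/-- By the Jacobi identity and induction on `j`. The extra `1` arises because index `k` stands for
degree `k + 1`. -/
theorem lie_mem_leftNormed {x : Fin n → g} {j k : ℕ} {a c : g} (ha : a ∈ leftNormed K x j)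
    (hc : c ∈ leftNormed K x k) : ⁅a, c⁆ ∈ leftNormed K x (j + k + 1) := by
  induction j generalizing a c k with
  | zero =>
    rw [zero_add]
    induction ha using Submodule.span_induction with
    | mem a h =>
      obtain ⟨i, rfl⟩ := h
      exact lie_mem_leftNormed_succ i hc
    | zero => rw [zero_lie]; exact zero_mem _
    | add a a' _ _ h h' => rw [add_lie]; exact add_mem h h'
    | smul t a _ h => rw [smul_lie]; exact Submodule.smul_mem _ _ h
  | succ j ih =>
    induction ha using Submodule.span_induction with
    | mem a h =>
      obtain ⟨i, v, hv, rfl⟩ := h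
      rw [lie_lie]
      have h1 := lie_mem_leftNormed_succ i (ih hv hc)
      have h2 := ih hv (lie_mem_leftNormed_succ i hc)
      rw [show j + 1 + k + 1 = j + k + 1 + 1 by omega]
      exact sub_mem h1 h2
    | zero => rw [zero_lie]; exact zero_mem _
    | add a a' _ _ h h' => rw [add_lie]; exact add_mem h h'
    | smul t a _ h => rw [smul_lie]; exact Submodule.smul_mem _ _ h

theorem stdBracket_mem_leftNormed (x : Fin n → g) {u : List (Fin n)} (hu : IsLyndon u) :
    stdBracket x u ∈ leftNormed K x (u.length - 1) := by
  refine IsLyndon.stdCut_induction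
    (P := fun u => stdBracket x u ∈ leftNormed K x (u.length - 1))
    (fun i => ?_) (fun w hw h ha hb => ?_) hu
  · rw [stdBracket_singleton]
    exact Submodule.subset_span ⟨i, rfl⟩
  · rw [stdBracket_of_two_le x h]
    have hcut := stdCut_mem h
    have := lie_mem_leftNormed ha hb
    rw [List.length_take, List.length_drop] at this
    convert this using 1
    congr 1
    omega

/-- The lift makes the degree of an element of `𝔤` visible in `K⟨X⟩`, where homogeneous components
can be compared. -/
theorem exists_mem_homSpan_of_mem_leftNormed (x : Fin n → g) {k : ℕ} {v : g}
    (hv : v ∈ leftNormed K x k) :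
    ∃ f ∈ homSpan K n (k + 1), evalHom K x f = UniversalEnvelopingAlgebra.ι K v := by
  have hx : ∀ i, FreeAlgebra.ι K i ∈ homSpan K n 1 := fun i =>
    Submodule.subset_span ⟨[i], rfl, wordBasis_singleton i⟩
  have hxi : ∀ i, evalHom K x (FreeAlgebra.ι K i) = UniversalEnvelopingAlgebra.ι K (x i) :=
    fun i => FreeAlgebra.lift_ι_apply _ _
  suffices h : leftNormed K x k ≤ ((homSpan K n (k + 1)).map (evalHom K x).toLinearMap).comap
      (UniversalEnvelopingAlgebra.ι K : g →ₗ⁅K⁆ _).toLinearMap from h hv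
  clear hv
  induction k with
  | zero =>
    refine Submodule.span_le.2 ?_
    rintro _ ⟨i, rfl⟩
    exact ⟨_, hx i, hxi i⟩
  | succ k ih =>
    refine Submodule.span_le.2 ?_
    rintro _ ⟨i, v, hv, rfl⟩
    obtain ⟨f, hf, hfv⟩ := ih hv
    refine ⟨⁅FreeAlgebra.ι K i, f⁆, ?_, ?_⟩
    · rw [LieRing.of_associative_ring_bracket]
      refine sub_mem ?_ (mul_mem_homSpan hf (hx i))
      rw [add_comm (k + 1)]
      exact mul_mem_homSpan (hx i) hf
    · have hfv' : evalHom K x f = UniversalEnvelopingAlgebra.ι K v := hfv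
      change evalHom K x _ = UniversalEnvelopingAlgebra.ι K ⁅x i, v⁆
      rw [LieHom.map_lie, LieRing.of_associative_ring_bracket, LieRing.of_associative_ring_bracket,
        map_sub, map_mul, map_mul, hfv', hxi]

variable {N W : Set (List (Fin n))}

/-- Expand `v` in the basis `[N]`, lift both sides to `K⟨X⟩` and take the component of degree `|u|`
of the difference, for a word `u` of the expansion. As `|u| ≠ k + 1`, the lift of `v` drops out, and
the relation left between bracketings forces the coefficient of `u` to vanish. -/
theorem leftNormed_eq_bot_of_inter_eq_empty (hNW : IsLyndonPair N W) {x : Fin n → g}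
    (hU : InClass K W fun i => UniversalEnvelopingAlgebra.ι K (x i)) {k : ℕ}
    (hk : N ∩ lyndonOfLength n (k + 1) = ∅) : leftNormed K x k = ⊥ := by
  classical
  obtain ⟨R, hR, hspan⟩ := hU.graded
  have hNL : ∀ u ∈ N, IsLyndon u := fun u hu => by
    rw [hNW.atoms] at hu
    exact hu.1
  rw [eq_bot_iff]
  intro v hv
  obtain ⟨f, hf, hfv⟩ := exists_mem_homSpan_of_mem_leftNormed x hv
  have hvtop : v ∈ Submodule.span K (stdBracket x '' N) := by
    rw [Set.image_eq_range, span_stdBracket_eq_top hNW x hU.generates hU.obstructions_eq]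
    exact Submodule.mem_top
  obtain ⟨c, hc, rfl⟩ := (Finsupp.mem_span_image_iff_linearCombination K).1 hvtop
  rw [Finsupp.mem_supported] at hc
  rw [Finsupp.linearCombination_apply, Finsupp.sum] at hfv ⊢
  have hmem : f - ∑ u ∈ c.support, c u • stdBracket (FreeAlgebra.ι K) u ∈ relations K x := by
    rw [mem_relations, map_sub, hfv, map_sum, map_sum, sub_eq_zero]
    refine Finset.sum_congr rfl fun u hu => ?_
    rw [map_smul, map_smul, evalHom_stdBracket x (hNL u (hc hu))]
  have hzero : ∀ u ∈ c.support, c u = 0 := by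
    intro u hu
    have hne : k + 1 ≠ u.length := fun h => by
      have : u ∈ N ∩ lyndonOfLength n (k + 1) := ⟨hc hu, hNL u (hc hu), h.symm⟩
      rw [hk] at this
      exact this
    have h1 : (degreeHom K n (f - ∑ u ∈ c.support, c u • stdBracket (FreeAlgebra.ι K) u)).coeff
        u.length ∈ relations K x := by
      rw [relations, hspan] at hmem ⊢
      exact coeff_degreeHom_mem (fun f hf => (hR f hf).imp fun _ h => h.2) hmem _
    rw [map_sub, degreeHom_of_mem_homSpan hf, Polynomial.coeff_sub,
      Polynomial.coeff_monomial_of_ne _ hne.symm, zero_sub, map_sum, Polynomial.finsetSum_coeff]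
      at h1
    have h2 := (relations K x).neg_mem h1
    rw [neg_neg] at h2
    have h3 : ∑ w ∈ c.support, (if w.length = u.length then c w else 0) •
        stdBracket (FreeAlgebra.ι K) w ∈ relations K x := by
      convert h2 using 1
      refine Finset.sum_congr rfl fun w hw => ?_
      rw [map_smul, degreeHom_of_mem_homSpan (stdBracket_mem_homSpan (hNL w (hc hw))),
        Polynomial.coeff_smul, Polynomial.coeff_monomial, ite_smul, zero_smul, smul_ite, smul_zero]
    simpa using eq_zero_of_sum_stdBracket_mem hNW hU.obstructions_eq _ hc h3 u hu
  rw [Submodule.mem_bot]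
  exact Finset.sum_eq_zero fun u hu => by rw [hzero u hu, zero_smul]

theorem leftNormed_le_lowerCentralSeries (x : Fin n → g) (k : ℕ) :
    leftNormed K x k ≤ (LieModule.lowerCentralSeries K g g k).toSubmodule := by
  induction k with
  | zero => simp
  | succ k ih =>
    refine Submodule.span_le.2 ?_
    rintro _ ⟨i, v, hv, rfl⟩
    rw [LieModule.lowerCentralSeries_succ]
    exact LieSubmodule.lie_mem_lie (LieSubmodule.mem_top _) (ih hv)

/-- By `lie_mem_leftNormed`, bracketing with any element raises the index by at least one. -/
theorem lowerCentralSeries_le_span (x : Fin n → g)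
    (htop : Submodule.span K {a | ∃ j, a ∈ leftNormed K x j} = ⊤) (k : ℕ) :
    (LieModule.lowerCentralSeries K g g k).toSubmodule ≤
      Submodule.span K {a | ∃ j, k ≤ j ∧ a ∈ leftNormed K x j} := by
  induction k with
  | zero => simp [htop]
  | succ k ih =>
    rw [LieModule.lowerCentralSeries_succ, LieSubmodule.lieIdeal_oper_eq_linear_span',
      Submodule.span_le]
    rintro _ ⟨a, -, c, hc, rfl⟩
    have ha : a ∈ Submodule.span K {a | ∃ j, a ∈ leftNormed K x j} := by simp [htop]
    refine Submodule.span_induction₂ (p := fun a c _ _ => ⁅a, c⁆ ∈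
      Submodule.span K {a | ∃ j, k + 1 ≤ j ∧ a ∈ leftNormed K x j}) ?_ ?_ ?_ ?_ ?_ ?_ ?_ ha (ih hc)
    · rintro a c ⟨i, hi⟩ ⟨j, hkj, hj⟩
      exact Submodule.subset_span ⟨i + j + 1, by omega, lie_mem_leftNormed hi hj⟩
    · intro c _; rw [zero_lie]; exact zero_mem _
    · intro a _; rw [lie_zero]; exact zero_mem _
    · intro a a' c _ _ _ h h'; rw [add_lie]; exact add_mem h h'
    · intro a c c' _ _ _ h h'; rw [lie_add]; exact add_mem h h'
    · intro t a c _ _ h; rw [smul_lie]; exact Submodule.smul_mem _ _ h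
    · intro t a c _ _ h; rw [lie_smul]; exact Submodule.smul_mem _ _ h

theorem leftNormed_eq_bot_of_le {x : Fin n → g} {k l : ℕ} (hkl : k ≤ l)
    (h : leftNormed K x k = ⊥) : leftNormed K x l = ⊥ := by
  induction l, hkl using Nat.le_induction with
  | base => exact h
  | succ l _ ih =>
    rw [leftNormed, ih, Submodule.span_eq_bot]
    rintro _ ⟨i, v, hv, rfl⟩
    rw [(Submodule.mem_bot K).1 hv, lie_zero]

theorem inter_eq_empty_of_leftNormed_eq_bot (hNW : IsLyndonPair N W) {x : Fin n → g}
    (hU : InClass K W fun i => UniversalEnvelopingAlgebra.ι K (x i)) {k : ℕ}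
    (hk : leftNormed K x k = ⊥) : N ∩ lyndonOfLength n (k + 1) = ∅ := by
  rw [Set.eq_empty_iff_forall_notMem]
  rintro u ⟨huN, hu, hlen⟩
  have h1 := stdBracket_mem_leftNormed (K := K) x hu
  rw [hlen, Nat.add_sub_cancel, hk, Submodule.mem_bot] at h1
  exact (linearIndepOn_stdBracket hNW x hU.obstructions_eq).ne_zero huN h1

/-- Both sides are equivalent to the vanishing of `leftNormed K x k`, which entails the vanishing of
all later ones. -/
theorem lowerCentralSeries_eq_bot_iff (hNW : IsLyndonPair N W) {x : Fin n → g}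
    (hU : InClass K W fun i => UniversalEnvelopingAlgebra.ι K (x i)) {k : ℕ} :
    LieModule.lowerCentralSeries K g g k = ⊥ ↔ N ∩ lyndonOfLength n (k + 1) = ∅ := by
  constructor
  · intro h
    refine inter_eq_empty_of_leftNormed_eq_bot hNW hU (eq_bot_iff.2 ?_)
    simpa [h] using leftNormed_le_lowerCentralSeries (K := K) x k
  · intro h
    have htop : Submodule.span K {a | ∃ j, a ∈ leftNormed K x j} = ⊤ := by
      rw [eq_top_iff, ← span_stdBracket_eq_top hNW x hU.generates hU.obstructions_eq]
      refine Submodule.span_mono ?_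
      rintro _ ⟨⟨u, hu⟩, rfl⟩
      rw [hNW.atoms] at hu
      exact ⟨_, stdBracket_mem_leftNormed x hu.1⟩
    have hbot := leftNormed_eq_bot_of_inter_eq_empty hNW hU h
    rw [← LieSubmodule.toSubmodule_eq_bot, eq_bot_iff]
    refine (lowerCentralSeries_le_span x htop k).trans (Submodule.span_le.2 ?_)
    rintro a ⟨j, hkj, ha⟩
    rwa [leftNormed_eq_bot_of_le hkj hbot] at ha

theorem inter_eq_empty_of_le (hNW : IsLyndonPair N W) {x : Fin n → g}
    (hU : InClass K W fun i => UniversalEnvelopingAlgebra.ι K (x i)) {s t : ℕ} (hs : 1 ≤ s)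
    (hst : s ≤ t) (h : N ∩ lyndonOfLength n s = ∅) : N ∩ lyndonOfLength n t = ∅ := by
  obtain ⟨s, rfl⟩ := Nat.exists_eq_add_of_le' hs
  obtain ⟨t, rfl⟩ := Nat.exists_eq_add_of_le' (hs.trans hst)
  exact inter_eq_empty_of_leftNormed_eq_bot hNW hU
    (leftNormed_eq_bot_of_le (by omega) (leftNormed_eq_bot_of_inter_eq_empty hNW hU h))

end Grading

/-! ### Closure properties and cardinality of `N`. -/

section Atoms

variable {n : ℕ} {N W : Set (List (Fin n))}

theorem IsLyndonPair.isLyndon (hNW : IsLyndonPair N W) {u : List (Fin n)} (hu : u ∈ N) :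
    IsLyndon u := by
  rw [hNW.atoms] at hu
  exact hu.1

theorem IsLyndonPair.singleton_mem (hNW : IsLyndonPair N W) (i : Fin n) : [i] ∈ N := by
  rw [hNW.atoms]
  refine ⟨isLyndon_singleton i, fun w hw hwi => ?_⟩
  have hne := (hNW.lyndon w hw).1
  have hlen := hwi.length_le
  have hpos := List.length_pos_iff.2 hne
  rw [List.length_singleton] at hlen
  have := hwi.eq_of_length (by rw [List.length_singleton]; omega)
  exact hNW.no_letter i (this ▸ hw)

theorem IsLyndonPair.mem_of_infix (hNW : IsLyndonPair N W) {u v : List (Fin n)} (hu : u ∈ N)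
    (hv : IsLyndon v) (hvu : v <:+: u) : v ∈ N := by
  rw [hNW.atoms] at hu ⊢
  exact ⟨hv, fun w hw hwv => hu.2 w hw (hwv.trans hvu)⟩

/-- A finite set containing the letters and words of every length `2, …, m` has at least
`n + m - 1` elements. -/
theorem add_le_ncard_add_one (hN : N.Finite) (hletters : ∀ i : Fin n, [i] ∈ N) {m : ℕ}
    (hm : ∀ s, 2 ≤ s → s ≤ m → ∃ u ∈ N, u.length = s) : n + m ≤ N.ncard + 1 := by
  classical
  set S := hN.toFinset with hS
  have hmem : ∀ u, u ∈ S ↔ u ∈ N := fun u => hN.mem_toFinset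
  have h1 : n ≤ (S.filter fun u => u.length = 1).card := by
    refine (Finset.card_fin n).ge.trans (Finset.card_le_card_of_injOn (fun i => [i]) (fun i _ => ?_)
      fun i _ j _ h => ?_)
    · simp [hmem, hletters]
    · simpa using h
  have h2 : m - 1 ≤ (S.filter fun u => ¬ u.length = 1).card := by
    have : (Finset.Icc 2 m).card = m - 1 := by rw [Nat.card_Icc]; omega
    rw [← this]
    refine Finset.card_le_card_of_surjOn List.length fun s hs => ?_
    rw [Finset.coe_Icc, Set.mem_Icc] at hs
    obtain ⟨u, hu, hus⟩ := hm s hs.1 hs.2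
    refine ⟨u, ?_, hus⟩
    rw [Finset.mem_coe, Finset.mem_filter, hmem]
    exact ⟨hu, by omega⟩
  have h3 := Finset.card_filter_add_card_filter_not (s := S) fun u => u.length = 1
  rw [Set.ncard_eq_toFinset_card N hN, ← hS]
  omega

end Atoms

end LyndonAtoms

theorem mainTheorem8 {K : Type*} [Field K] [CharZero K] {n : ℕ} (hn : 2 ≤ n)
    (N W : Set (List (Fin n))) (hNW : LyndonAtoms.IsLyndonPair N W)
    {g : Type*} [LieRing g] [LieAlgebra K g] (x : Fin n → g)
    (hU : LyndonAtoms.InClass K W (fun i => UniversalEnvelopingAlgebra.ι K (x i))) :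
    (∀ s, 2 ≤ s → N ∩ LyndonAtoms.lyndonOfLength n s = ∅ →
      (∀ k, 1 ≤ k → N ∩ LyndonAtoms.lyndonOfLength n (s + k) = ∅) ∧ N.Finite) ∧
    (∀ s, IsLeast {t | 2 ≤ t ∧ N ∩ LyndonAtoms.lyndonOfLength n t = ∅} s →
      LyndonAtoms.IsNilpotentOfClass K g (s - 1)) ∧
    (N.Infinite → ∀ m, 1 ≤ m → (N ∩ LyndonAtoms.lyndonOfLength n m).Nonempty) ∧
    (N.Finite → ∃ m : ℕ, IsGreatest (List.length '' N) m ∧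
      LyndonAtoms.IsNilpotentOfClass K g m ∧ (m : ℤ) ≤ (N.ncard : ℤ) - n + 1) ∧
    LyndonAtoms.IsConnectedAtoms N ∧
    ∃ b : Module.Basis N K g, ∀ u : N, b u = LyndonAtoms.stdBracket x (u : List (Fin n)) := by
  have hone : N ∩ LyndonAtoms.lyndonOfLength n 1 ≠ ∅ := fun h => by
    have : [(⟨0, by omega⟩ : Fin n)] ∈ N ∩ LyndonAtoms.lyndonOfLength n 1 :=
      ⟨hNW.singleton_mem _, LyndonAtoms.isLyndon_singleton _, rfl⟩
    rw [h] at this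
    exact this
  have hfin : ∀ s, 1 ≤ s → N ∩ LyndonAtoms.lyndonOfLength n s = ∅ → N.Finite := by
    intro s hs h
    refine (List.finite_length_le (Fin n) s).subset fun u hu => ?_
    by_contra hlt
    have : u ∈ N ∩ LyndonAtoms.lyndonOfLength n u.length := ⟨hu, hNW.isLyndon hu, rfl⟩
    rw [LyndonAtoms.inter_eq_empty_of_le hNW hU hs (not_le.1 hlt).le h] at this
    exact this
  refine ⟨fun s hs h => ⟨fun k _ => ?_, hfin s (by omega) h⟩, fun s hs => ⟨?_, fun k hk => ?_⟩,
    fun hinf m hm => ?_, fun hN => ?_, ⟨fun u hu => hNW.isLyndon hu, hNW.singleton_mem,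
    fun u hu v hv hvu => hNW.mem_of_infix hu hv hvu, fun m hm hne s hs hsm => ?_⟩, ?_⟩
  · exact LyndonAtoms.inter_eq_empty_of_le hNW hU (by omega) (by omega) h
  · refine (LyndonAtoms.lowerCentralSeries_eq_bot_iff hNW hU).2 ?_
    rw [Nat.sub_add_cancel (by have := hs.1.1; omega)]
    exact hs.1.2
  · have hk' := (LyndonAtoms.lowerCentralSeries_eq_bot_iff hNW hU).1 hk
    -- Minimality of `s` is only among lengths at least `2`; `k = 0` would mean length `1`, which
    -- the letters rule out.
    have hk0 : k ≠ 0 := by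
      rintro rfl
      exact hone hk'
    have := hs.2 ⟨by omega, hk'⟩
    omega
  · rw [Set.nonempty_iff_ne_empty]
    exact fun h => hinf (hfin m hm h)
  · have hNne : N.Nonempty := ⟨_, hNW.singleton_mem ⟨0, by omega⟩⟩
    obtain ⟨u, hu, hmax⟩ := Set.exists_max_image N List.length hN hNne
    have hupos := List.length_pos_iff.2 (hNW.isLyndon hu).1
    have hne : ∀ s, 1 ≤ s → s ≤ u.length → N ∩ LyndonAtoms.lyndonOfLength n s ≠ ∅ := by
      intro s hs hsu h
      have : u ∈ N ∩ LyndonAtoms.lyndonOfLength n u.length := ⟨hu, hNW.isLyndon hu, rfl⟩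
      rw [LyndonAtoms.inter_eq_empty_of_le hNW hU hs hsu h] at this
      exact this
    refine ⟨u.length, ⟨⟨u, hu, rfl⟩, ?_⟩, ⟨?_, fun k hk => ?_⟩, ?_⟩
    · rintro _ ⟨v, hv, rfl⟩
      exact hmax v hv
    · refine (LyndonAtoms.lowerCentralSeries_eq_bot_iff hNW hU).2 ?_
      rw [Set.eq_empty_iff_forall_notMem]
      rintro v ⟨hv, -, hlen⟩
      have := hmax v hv
      omega
    · by_contra! hlt
      exact hne (k + 1) (by omega) hlt ((LyndonAtoms.lowerCentralSeries_eq_bot_iff hNW hU).1 hk)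
    · have := LyndonAtoms.add_le_ncard_add_one hN hNW.singleton_mem (m := u.length)
        fun s hs hsu => by
          obtain ⟨v, hv, hv'⟩ := Set.nonempty_iff_ne_empty.2 (hne s (by omega) hsu)
          exact ⟨v, hv, hv'.2⟩
      omega
  · rw [Set.nonempty_iff_ne_empty] at hne ⊢
    exact fun h => hne (LyndonAtoms.inter_eq_empty_of_le hNW hU hs hsm h)
  · exact ⟨Module.Basis.mk (LyndonAtoms.linearIndepOn_stdBracket hNW x hU.obstructions_eq)
      (LyndonAtoms.span_stdBracket_eq_top hNW x hU.generates hU.obstructions_eq).ge,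
      fun u => Module.Basis.mk_apply _ _ u⟩
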